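/- **Theorem 1.** Graphs are finite and undirected, possibly with loops and parallel edges; a loop counts twice in the degree of its vertex. A graph $G=(V,E)$ is the *homomorphic image* of a graph $H=(W,F)$ by an onto function $\varphi:W\to V$ if for any two vertices $u,v\in V$ (possibly $u=v$) the number of edges of $G$ between $u$ and $v$ equals the number of edges of $H$ whose endpoints are mapped by $\varphi$ to $\{u,v\}$. For an integer $k>0$, $G$ is a *$k$-trail* if it is the homomorphic image of a connected graph of maximum degree at most $k$, and a *$k$-tree* is a tree of maximum degree at most $k$. There is a polynomial-time algorithm that, given a connected graph $G=(V,E)$ with at least two vertices and an integer $k>0$ (written in binary), decides whether $G$ is a $k$-trail and, if it is, outputs a $k$-tree $H=(W,F)$ and an onto function $\varphi:W\to V$ such that $G$ is the homomorphic image of $H$ by $\varphi$. (Here an algorithm is a random access machine program with addition and truncated subtraction as its only arithmetic operations, each operation having unit cost, and polynomial time means at most $p(|V|+|E|+\lceil\log_2(k+1)\rceil)$ for a fixed polynomial $p$.) -/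

import Mathlib

/-! ### Finite multigraphs, homomorphic images, `k`-trails and `k`-trees

Undirected graphs with possible loops and parallel edges are Mathlib's `Graph α β`
(vertices in `α`, edges in `β`). -/

namespace KTrail

open Graph

/-- The degree of a vertex: the number of edges incident with it, loops being counted twice. -/
noncomputable def degree {α β : Type*} (G : Graph α β) (v : α) : ℕ :=
  {e | G.Inc e v}.ncard + {e | G.IsLoopAt e v}.ncard

/-- Connectedness (which includes having at least one vertex). Loops and parallel edges do not
matter for it, so it is read off the underlying simple graph. -/
def IsConnected {α β : Type*} (G : Graph α β) : Prop :=
  G.toSimpleGraph.Connected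

/-- All degrees are at most `k`. -/
def MaxDegreeLE {α β : Type*} (G : Graph α β) (k : ℕ) : Prop :=
  ∀ v ∈ V(G), degree G v ≤ k

/-- Trees: no loops, no parallel edges, and the underlying simple graph is a tree. -/
def IsTree {α β : Type*} (G : Graph α β) : Prop :=
  G.Simple ∧ G.toSimpleGraph.IsTree

/-- `k`-trees: trees of maximum degree at most `k`. -/
def IsKTree {α β : Type*} (G : Graph α β) (k : ℕ) : Prop :=
  IsTree G ∧ MaxDegreeLE G k

/-- `G` is the homomorphic image of `H` by `φ`: the function `φ` maps the vertices of `H` onto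
those of `G`, and for any two (possibly equal) vertices `u`, `v` of `G`, the number of edges of `G`
between `u` and `v` is the number of edges of `H` whose ends are mapped by `φ` to `u` and `v`. -/
structure IsHomImageBy {α β γ δ : Type*} (G : Graph α β) (H : Graph γ δ) (φ : γ → α) : Prop where
  image_eq : φ '' V(H) = V(G)
  ncard_eq : ∀ u ∈ V(G), ∀ v ∈ V(G),
    {e | G.IsLink e u v}.ncard = {f | ∃ x y, H.IsLink f x y ∧ s(φ x, φ y) = s(u, v)}.ncard

/-- `G` is a `k`-trail: it is the homomorphic image of a finite connected graph of maximum degree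
at most `k`. -/
def IsKTrail {α β : Type*} (G : Graph α β) (k : ℕ) : Prop :=
  ∃ (γ δ : Type) (H : Graph γ δ) (φ : γ → α),
    V(H).Finite ∧ E(H).Finite ∧ IsConnected H ∧ MaxDegreeLE H k ∧ IsHomImageBy G H φ

/-- A finite multigraph as an algorithm sees it: `n` vertices `0, …, n - 1` and a list of `m` edges,
each given by its two ends. -/
structure EdgeList where
  /-- the number of vertices -/
  n : ℕ
  /-- the number of edges -/
  m : ℕ
  /-- the two ends of each edge -/
  ends : Fin m → Fin n × Fin n

/-- The multigraph described by an edge list. -/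
def EdgeList.toGraph (G : EdgeList) : Graph (Fin G.n) (Fin G.m) where
  vertexSet := Set.univ
  edgeSet := Set.univ
  IsLink e x y := s((G.ends e).1, (G.ends e).2) = s(x, y)
  isLink_symm := fun _ _ => ⟨fun _ _ h => h.trans Sym2.eq_swap⟩
  eq_or_eq_of_isLink_of_isLink := fun e x y v w h h' => by
    have hh := h.symm.trans h'
    rw [Sym2.eq_iff] at hh
    tauto
  edge_mem_iff_exists_isLink := fun e => ⟨fun _ => ⟨_, _, rfl⟩, fun _ => trivial⟩
  left_mem_of_isLink := fun _ _ _ _ => trivial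

end KTrail

/-! ### Random access machines

Programs of a random access machine whose memory cells hold natural numbers, in structured form.
The memory consists of scalar registers and of arrays; a program mentions finitely many of either.
The arithmetic is addition and truncated subtraction only. Every operation has unit cost; since
there is no multiplication, the lengths of the numbers in memory grow by at most a constant in every
unit of time, so that polynomial time on this machine is polynomial time on Turing machines. -/

namespace Ram

/-- The contents of the memory. -/
structure State where
  /-- the scalar registers -/
  reg : ℕ → ℕ
  /-- the arrays: `arr a i` is entry `i` of array `a` -/
  arr : ℕ → ℕ → ℕ

/-- Arithmetic expressions. -/
inductive Expr where
  /-- a constant -/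
  | const (c : ℕ)
  /-- the contents of a register -/
  | reg (r : ℕ)
  /-- the entry of an array at a computed index -/
  | get (a : ℕ) (idx : Expr)
  /-- sum -/
  | add (x y : Expr)
  /-- difference, zero if negative -/
  | sub (x y : Expr)

/-- The value of an expression. -/
def Expr.eval (s : State) : Expr → ℕ
  | .const c => c
  | .reg r => s.reg r
  | .get a idx => s.arr a (idx.eval s)
  | .add x y => x.eval s + y.eval s
  | .sub x y => x.eval s - y.eval s

/-- The time it takes to evaluate an expression: the number of operations in it. -/
def Expr.cost : Expr → ℕ
  | .const _ => 1
  | .reg _ => 1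
  | .get _ idx => idx.cost + 1
  | .add x y => x.cost + y.cost + 1
  | .sub x y => x.cost + y.cost + 1

/-- Programs. -/
inductive Prog where
  /-- do nothing -/
  | skip
  /-- write the value of an expression into a register -/
  | assign (r : ℕ) (x : Expr)
  /-- write the value of `x` into array `a` at the index given by `idx` -/
  | store (a : ℕ) (idx x : Expr)
  /-- run `P`, then `Q` -/
  | seq (P Q : Prog)
  /-- run `P` if the value of `x` is non-zero, and `Q` otherwise -/
  | cond (x : Expr) (P Q : Prog)
  /-- run `P` as long as the value of `x` is non-zero -/
  | loop (x : Expr) (P : Prog)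

/-- The memory after writing `c` into register `r`. -/
def State.setReg (s : State) (r c : ℕ) : State :=
  { s with reg := Function.update s.reg r c }

/-- The memory after writing `c` into array `a` at index `i`. -/
def State.setArr (s : State) (a i c : ℕ) : State :=
  { s with arr := Function.update s.arr a (Function.update (s.arr a) i c) }

/-- `Runs P s t s'`: the program `P`, started with memory `s`, halts after time `t` with
memory `s'`. -/
inductive Runs : Prog → State → ℕ → State → Prop where
  | skip (s : State) : Runs .skip s 1 s
  | assign (r : ℕ) (x : Expr) (s : State) :
      Runs (.assign r x) s (x.cost + 1) (s.setReg r (x.eval s))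
  | store (a : ℕ) (idx x : Expr) (s : State) :
      Runs (.store a idx x) s (idx.cost + x.cost + 1) (s.setArr a (idx.eval s) (x.eval s))
  | seq {P Q : Prog} {s₁ s₂ s₃ : State} {t u : ℕ} :
      Runs P s₁ t s₂ → Runs Q s₂ u s₃ → Runs (.seq P Q) s₁ (t + u) s₃
  | cond_true {x : Expr} {P Q : Prog} {s₁ s₂ : State} {t : ℕ} :
      x.eval s₁ ≠ 0 → Runs P s₁ t s₂ → Runs (.cond x P Q) s₁ (x.cost + 1 + t) s₂
  | cond_false {x : Expr} {P Q : Prog} {s₁ s₂ : State} {t : ℕ} :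
      x.eval s₁ = 0 → Runs Q s₁ t s₂ → Runs (.cond x P Q) s₁ (x.cost + 1 + t) s₂
  | loop_true {x : Expr} {P : Prog} {s₁ s₂ s₃ : State} {t u : ℕ} :
      x.eval s₁ ≠ 0 → Runs P s₁ t s₂ → Runs (.loop x P) s₂ u s₃ →
        Runs (.loop x P) s₁ (x.cost + 1 + t + u) s₃
  | loop_false {x : Expr} {P : Prog} {s : State} :
      x.eval s = 0 → Runs (.loop x P) s (x.cost + 1) s

end Ram

namespace KTrail

/-- The memory that a program finds on input `(G, k)`: register `0` holds `k`, registers `1` and `2`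
hold the numbers of vertices and edges of `G`, arrays `0` and `1` hold the two ends of the edges,
and everything else is zero. -/
def inputState (G : EdgeList) (k : ℕ) : Ram.State where
  reg r := if r = 0 then k else if r = 1 then G.n else if r = 2 then G.m else 0
  arr a e :=
    if h : e < G.m then
      if a = 0 then (G.ends ⟨e, h⟩).1 else if a = 1 then (G.ends ⟨e, h⟩).2 else 0
    else 0

/-- The length of the input `(G, k)`: the number of vertices plus the number of edges plus the
number of binary digits of `k`. -/
def inputSize (G : EdgeList) (k : ℕ) : ℕ :=
  G.n + G.m + k.size

/-- The memory `s` contains, in the input format, the graph `H`, and in array `2` the values of the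
map `φ` on the vertices of `H`. -/
def Outputs (s : Ram.State) (H : EdgeList) {n : ℕ} (φ : Fin H.n → Fin n) : Prop :=
  s.reg 1 = H.n ∧ s.reg 2 = H.m ∧
    (∀ e : Fin H.m, s.arr 0 e = (H.ends e).1 ∧ s.arr 1 e = (H.ends e).2) ∧
    ∀ w : Fin H.n, s.arr 2 w = φ w

end KTrail

/-! Root a tree H over G at a copy of the vertex 0 and direct its edges away from the root. Every
other vertex of H is the head of exactly one edge, so the induced orientation D of G determines the
number of copies of each v: its indegree, plus one if v = 0. In D all vertices are reachable from 0,
and the degrees of the copies of v add up to deg v, so deg v ≤ k · copies v is necessary for H to be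
a k-tree. Conversely, a rooted orientation with these inequalities suffices: any tree built over D
can be repaired by moving edges from an overfull copy of a vertex to an underfull copy of the same
vertex (`deg_le_of_stuck`).

It remains to find such an orientation or to see that G is no k-trail. If v has too few copies and u
can spare one, reversing a directed path from v to u trades a copy of u for one of v. When there is
no such path, or when the reversal destroys reachability from 0, some tight set contains u and not v
(`Arcs.tight_of_unreached`, `Arcs.Trade.tight_of_unreached`); a set is tight if it is entered by as
few edges as reachability permits. By submodularity, intersecting tight sets have a tight union
(`Arcs.Tight.union`), so the maximal tight sets avoiding v are disjoint. Contract them. If the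
search is stuck at v, a connected graph of maximum degree at most k over G needs at least as many
copies as D of each vertex outside these sets, and more copies of v; but then it has too few edges
to be connected (`Arcs.false_of_stuck`). The argument covers every connected H, not only trees.

Both local searches decrease a sum of defects that is at most quadratic in the numbers of vertices
and edges, whatever k is. Bounding the iterations of every loop therefore bounds the time of the
fixed program by a polynomial (`Prog.time`). -/

namespace Ram

/-! ### A program logic for the random access machine -/

/-- Whether a program contains no write to register `r`. -/
def Prog.keepsReg (r : ℕ) : Prog → Bool
  | .skip => true
  | .assign r' _ => r' != r
  | .store _ _ _ => true
  | .seq P Q => P.keepsReg r && Q.keepsReg r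
  | .cond _ P Q => P.keepsReg r && Q.keepsReg r
  | .loop _ P => P.keepsReg r

/-- Whether a program contains no write to array `a`. -/
def Prog.keepsArr (a : ℕ) : Prog → Bool
  | .skip => true
  | .assign _ _ => true
  | .store a' _ _ => a' != a
  | .seq P Q => P.keepsArr a && Q.keepsArr a
  | .cond _ P Q => P.keepsArr a && Q.keepsArr a
  | .loop _ P => P.keepsArr a

theorem Runs.reg_eq {P : Prog} {s s' : State} {t r : ℕ} (h : Runs P s t s')
    (hP : P.keepsReg r = true) : s'.reg r = s.reg r := by
  induction h with
  | skip => rfl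
  | assign r' x s =>
    have : r' ≠ r := by simpa [Prog.keepsReg] using hP
    simp [State.setReg, Function.update_of_ne this.symm]
  | store => rfl
  | seq _ _ ih₁ ih₂ =>
    simp only [Prog.keepsReg, Bool.and_eq_true] at hP
    rw [ih₂ hP.2, ih₁ hP.1]
  | cond_true _ _ ih =>
    simp only [Prog.keepsReg, Bool.and_eq_true] at hP
    exact ih hP.1
  | cond_false _ _ ih =>
    simp only [Prog.keepsReg, Bool.and_eq_true] at hP
    exact ih hP.2
  | loop_true _ _ _ ih₁ ih₂ => rw [ih₂ hP, ih₁ (by simpa [Prog.keepsReg] using hP)]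
  | loop_false => rfl

theorem Runs.arr_eq {P : Prog} {s s' : State} {t a : ℕ} (h : Runs P s t s')
    (hP : P.keepsArr a = true) : s'.arr a = s.arr a := by
  induction h with
  | skip => rfl
  | assign => rfl
  | store a' =>
    have : a' ≠ a := by simpa [Prog.keepsArr] using hP
    simp [State.setArr, Function.update_of_ne this.symm]
  | seq _ _ ih₁ ih₂ =>
    simp only [Prog.keepsArr, Bool.and_eq_true] at hP
    rw [ih₂ hP.2, ih₁ hP.1]
  | cond_true _ _ ih =>
    simp only [Prog.keepsArr, Bool.and_eq_true] at hP
    exact ih hP.1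
  | cond_false _ _ ih =>
    simp only [Prog.keepsArr, Bool.and_eq_true] at hP
    exact ih hP.2
  | loop_true _ _ _ ih₁ ih₂ => rw [ih₂ hP, ih₁ (by simpa [Prog.keepsArr] using hP)]
  | loop_false => rfl

/-- A bound on the running time of a program all of whose loops are iterated at most `L` times. -/
def Prog.time {R : Type*} [Semiring R] (L : R) : Prog → R
  | .skip => 1
  | .assign _ x => x.cost + 1
  | .store _ idx x => idx.cost + x.cost + 1
  | .seq P Q => P.time L + Q.time L
  | .cond x P Q => x.cost + 1 + (P.time L + Q.time L)
  | .loop x P => (L + 1) * (x.cost + 1 + P.time L)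

/-- The semiring in `Prog.time` is arbitrary so that one formula is both a number and a polynomial;
evaluation respects sums and products. A polynomial bound on iterations thus gives one on time. -/
theorem Prog.eval_time (P : Prog) (p : Polynomial ℕ) (N : ℕ) :
    (P.time p).eval N = P.time (p.eval N) := by
  induction P <;> simp_all [Prog.time]

/-- Total correctness: started in memory `s`, the program `P` halts with a memory satisfying `Q`,
within the time that results from iterating every loop at most `L` times. -/
def Run (L : ℕ) (P : Prog) (s : State) (Q : State → Prop) : Prop :=
  ∃ t s', Runs P s t s' ∧ t ≤ P.time L ∧ Q s'

variable {L : ℕ} {P P' : Prog} {s : State} {Q Q' : State → Prop} {x : Expr}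

theorem Run.mono (h : Run L P s Q) (hQ : ∀ s', Q s' → Q' s') : Run L P s Q' := by
  obtain ⟨t, s', h₁, h₂, h₃⟩ := h
  exact ⟨t, s', h₁, h₂, hQ _ h₃⟩

/-- What a program that does not write to certain registers and arrays has kept. -/
structure Frame (P : Prog) (s s' : State) : Prop where
  reg : ∀ r, P.keepsReg r = true → s'.reg r = s.reg r
  arr : ∀ a, P.keepsArr a = true → s'.arr a = s.arr a

/-- What is kept can be read off the program text. The conditions are Boolean, so for concrete
programs they hold by `rfl`, and specifications need only mention what changes. -/
theorem Run.frame (h : Run L P s Q) : Run L P s fun s' => Q s' ∧ Frame P s s' := by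
  obtain ⟨t, s', h₁, h₂, h₃⟩ := h
  exact ⟨t, s', h₁, h₂, h₃, fun r hr => h₁.reg_eq hr, fun a ha => h₁.arr_eq ha⟩

theorem Run.skip (h : Q s) : Run L .skip s Q :=
  ⟨_, _, .skip s, by simp [Prog.time], h⟩

theorem Run.assign {r : ℕ} (h : Q (s.setReg r (x.eval s))) : Run L (.assign r x) s Q :=
  ⟨_, _, .assign r x s, by simp [Prog.time], h⟩

theorem Run.store {a : ℕ} {idx : Expr} (h : Q (s.setArr a (idx.eval s) (x.eval s))) :
    Run L (.store a idx x) s Q :=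
  ⟨_, _, .store a idx x s, by simp [Prog.time], h⟩

theorem Run.seq (h : Run L P s Q') (h' : ∀ s', Q' s' → Run L P' s' Q) :
    Run L (.seq P P') s Q := by
  obtain ⟨t, s', h₁, h₂, h₃⟩ := h
  obtain ⟨t', s'', h₁', h₂', h₃'⟩ := h' s' h₃
  exact ⟨_, _, .seq h₁ h₁', by simp only [Prog.time]; omega, h₃'⟩

theorem Run.assign_seq {r : ℕ} (h : Run L P (s.setReg r (x.eval s)) Q) :
    Run L (.seq (.assign r x) P) s Q :=
  Run.seq (Q' := (· = s.setReg r (x.eval s))) (.assign rfl) fun _ h' => h' ▸ h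

theorem Run.store_seq {a : ℕ} {idx : Expr}
    (h : Run L P (s.setArr a (idx.eval s) (x.eval s)) Q) :
    Run L (.seq (.store a idx x) P) s Q :=
  Run.seq (Q' := (· = s.setArr a (idx.eval s) (x.eval s))) (.store rfl) fun _ h' => h' ▸ h

theorem Run.cond (h : x.eval s ≠ 0 → Run L P s Q) (h' : x.eval s = 0 → Run L P' s Q) :
    Run L (.cond x P P') s Q := by
  by_cases hx : x.eval s = 0
  · obtain ⟨t, s', h₁, h₂, h₃⟩ := h' hx
    exact ⟨_, _, .cond_false hx h₁, by simp only [Prog.time, Nat.cast_id]; omega, h₃⟩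
  · obtain ⟨t, s', h₁, h₂, h₃⟩ := h hx
    exact ⟨_, _, .cond_true hx h₁, by simp only [Prog.time, Nat.cast_id]; omega, h₃⟩

/-- Besides at most `L` iterations there is one last test of the condition; hence the factor `L + 1`
in `Prog.time`. -/
theorem Run.loop_aux (Inv : State → Prop) (μ : State → ℕ)
    (hstep : ∀ s, Inv s → x.eval s ≠ 0 → Run L P s fun s' => Inv s' ∧ μ s' < μ s)
    (h0 : Inv s) (hμ : μ s ≤ L) (hQ : ∀ s', Inv s' → x.eval s' = 0 → Q s') :
    Run L (.loop x P) s Q := by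
  have key : ∀ n s, Inv s → μ s ≤ n → ∃ t s', Runs (.loop x P) s t s' ∧
      t ≤ (n + 1) * (x.cost + 1 + P.time L) ∧ Q s' := by
    intro n
    induction n with
    | zero =>
      intro s hs hn
      by_cases hx : x.eval s = 0
      · exact ⟨_, s, .loop_false hx, by linarith [Nat.zero_le (P.time L)], hQ _ hs hx⟩
      · obtain ⟨t, s', _, _, _, h₄⟩ := hstep s hs hx
        omega
    | succ n ih =>
      intro s hs hn
      by_cases hx : x.eval s = 0
      · exact ⟨_, s, .loop_false hx, by
          nlinarith [Nat.zero_le (P.time L), Nat.zero_le (n * (x.cost + 1 + P.time L))],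
          hQ _ hs hx⟩
      · obtain ⟨t, s', h₁, h₂, h₃, h₄⟩ := hstep s hs hx
        obtain ⟨t', s'', h₁', h₂', h₃'⟩ := ih s' h₃ (by omega)
        exact ⟨_, s'', .loop_true hx h₁ h₁', by nlinarith, h₃'⟩
  obtain ⟨t, s', h₁, h₂, h₃⟩ := key L s h0 hμ
  exact ⟨t, s', h₁, by simpa [Prog.time] using h₂, h₃⟩

/-- A loop with a decreasing measure. -/
theorem Run.loop (Inv : State → Prop) (μ : State → ℕ)
    (hstep : ∀ s', Inv s' → Frame P s s' → x.eval s' ≠ 0 →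
      Run L P s' fun s'' => Inv s'' ∧ μ s'' < μ s')
    (h0 : Inv s) (hμ : μ s ≤ L) (hQ : ∀ s', Inv s' → Frame P s s' → x.eval s' = 0 → Q s') :
    Run L (.loop x P) s Q := by
  refine Run.loop_aux (fun s' => Inv s' ∧ Frame P s s') μ ?_ ⟨h0, fun _ _ => rfl, fun _ _ => rfl⟩
    hμ fun s' h => hQ s' h.1 h.2
  rintro s' ⟨h₁, h₂⟩ hx
  refine (hstep s' h₁ h₂ hx).frame.mono fun s'' ⟨⟨h₃, h₄⟩, h₅⟩ => ⟨⟨h₃, ?_⟩, h₄⟩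
  exact ⟨fun r hr => (h₅.reg r hr).trans (h₂.reg r hr),
    fun a ha => (h₅.arr a ha).trans (h₂.arr a ha)⟩

/-- `for i = 0, …, (register b) - 1 do P`. -/
def Prog.forTo (i b : ℕ) (P : Prog) : Prog :=
  .seq (.assign i (.const 0))
    (.loop (.sub (.reg b) (.reg i)) (.seq P (.assign i (.add (.reg i) (.const 1)))))

@[simp]
theorem State.setReg_reg (s : State) (r c r' : ℕ) :
    (s.setReg r c).reg r' = if r' = r then c else s.reg r' := by
  simp [State.setReg, Function.update_apply]

@[simp]
theorem State.setReg_arr (s : State) (r c a : ℕ) : (s.setReg r c).arr a = s.arr a := rfl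

@[simp]
theorem State.setArr_reg (s : State) (a i c r : ℕ) : (s.setArr a i c).reg r = s.reg r := rfl

@[simp]
theorem State.setArr_arr (s : State) (a i c a' : ℕ) :
    (s.setArr a i c).arr a' = if a' = a then Function.update (s.arr a) i c else s.arr a' := by
  simp [State.setArr, Function.update_apply]

/-- The invariant refers to the memory after the counter has been advanced, hence the `setReg` in
the step. Whatever neither `P` nor the counter touches is available in the step for free. -/
theorem Run.forTo {i b n : ℕ} (Inv : ℕ → State → Prop) (hb : s.reg b = n)
    (hP : (P.keepsReg i && P.keepsReg b && (b != i)) = true) (hn : n ≤ L)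
    (h0 : Inv 0 (s.setReg i 0))
    (hstep : ∀ j < n, ∀ s', Inv j s' → s'.reg i = j →
      (∀ r, (P.keepsReg r && (r != i)) = true → s'.reg r = s.reg r) →
      (∀ a, P.keepsArr a = true → s'.arr a = s.arr a) →
      Run L P s' fun s'' => Inv (j + 1) (s''.setReg i (j + 1)))
    (hQ : ∀ s', Inv n s' → Q s') : Run L (.forTo i b P) s Q := by
  simp only [Bool.and_eq_true, bne_iff_ne] at hP
  obtain ⟨⟨hi, hb'⟩, hne⟩ := hP
  refine Run.assign_seq (Run.loop (fun s => Inv (s.reg i) s ∧ s.reg b = n ∧ s.reg i ≤ n)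
    (fun s => n - s.reg i) ?_ ?_ ?_ ?_)
  · rintro s' ⟨h₁, h₂, h₃⟩ hf hx
    simp only [Expr.eval, h₂] at hx
    refine Run.seq (hstep _ (by omega) s' h₁ rfl (fun r hr => ?_) (fun a ha => ?_)).frame
      fun s'' ⟨h₄, h₅⟩ => Run.assign ?_
    · simp only [Bool.and_eq_true, bne_iff_ne] at hr
      rw [hf.reg r (by simp [Prog.keepsReg, hr.1, hr.2.symm])]
      simp [State.setReg_reg, hr.2]
    · rw [hf.arr a (by simp [Prog.keepsArr, ha])]
      rfl
    · have hr : s''.reg i = s'.reg i := h₅.reg i hi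
      simp only [Expr.eval, hr]
      refine ⟨⟨?_, ?_, ?_⟩, ?_⟩
      · simpa [State.setReg_reg] using h₄
      · rw [State.setReg_reg, if_neg hne, h₅.reg b hb', h₂]
      · simp [State.setReg_reg]; omega
      · simp [State.setReg_reg]; omega
  · refine ⟨?_, ?_, ?_⟩
    · simpa [State.setReg_reg, Expr.eval] using h0
    · rw [State.setReg_reg, if_neg hne, hb]
    · simp [State.setReg_reg, Expr.eval]
  · exact (Nat.sub_le _ _).trans hn
  · rintro s' ⟨h₁, h₂, h₃⟩ - hx
    simp only [Expr.eval, h₂] at hx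
    have : s'.reg i = n := by omega
    exact hQ _ (this ▸ h₁)

/-! ### Local search -/

section Search

variable {α : Type*} {Rep : α → State → Prop} {μ : α → ℕ} {fl : ℕ}

/-- The outcome of trying an improvement step on the object `a`: either `a` has been replaced by an
object of smaller measure and the flag has been raised, or `a` and the flag are as before and `F`
tells why. -/
def Progress (Rep : α → State → Prop) (μ : α → ℕ) (fl : ℕ) (s : State) (a : α) (F : Prop)
    (s' : State) : Prop :=
  (∃ a', Rep a' s' ∧ μ a' < μ a ∧ s'.reg fl = 1) ∨ (Rep a s' ∧ s'.reg fl = s.reg fl ∧ F)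

/-- Repeat `P` until it no longer raises the flag. -/
def Prog.search (fl : ℕ) (P : Prog) : Prog :=
  .seq (.assign fl (.const 1)) (.loop (.reg fl) (.seq (.assign fl (.const 0)) P))

theorem Run.search {F : α → Prop} (hfl : ∀ a s c, Rep a s → Rep a (s.setReg fl c))
    (hP : ∀ a s, Rep a s → Run L P s (Progress Rep μ fl s a (F a)))
    {a : α} (h0 : Rep a s) (hL : μ a < L) (hQ : ∀ a s', Rep a s' → F a → Q s') :
    Run L (.search fl P) s Q := by
  classical
  -- A memory may represent several objects, so its measure is the least one over all of them. The
  -- flag is added so that the last round, which changes no object but lowers the flag from 1 to 0,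
  -- also decreases the measure; this is why `μ a < L` is strict.
  have : ∃ ν : State → ℕ, ∀ s, (∃ a, Rep a s ∧ μ a + s.reg fl ≤ L) →
      ∃ a, Rep a s ∧ μ a + s.reg fl ≤ L ∧ ν s = μ a + s.reg fl ∧
        ∀ a', Rep a' s → ν s ≤ μ a' + s.reg fl := by
    refine ⟨fun s => sInf {x | ∃ a, Rep a s ∧ x = μ a + s.reg fl}, fun s ⟨a, ha, hL⟩ => ?_⟩
    have hne : {x | ∃ a, Rep a s ∧ x = μ a + s.reg fl}.Nonempty := ⟨_, a, ha, rfl⟩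
    obtain ⟨a', h₁, h₂⟩ := Nat.sInf_mem hne
    exact ⟨a', h₁, (h₂.symm.trans_le (Nat.sInf_le ⟨a, ha, rfl⟩)).trans hL, h₂,
      fun a'' h => Nat.sInf_le ⟨a'', h, rfl⟩⟩
  obtain ⟨ν, hν⟩ := this
  refine Run.assign_seq (Run.loop
    (fun s => (∃ a, Rep a s ∧ μ a + s.reg fl ≤ L) ∧ s.reg fl ≤ 1 ∧
      (s.reg fl = 0 → ∃ a, Rep a s ∧ F a)) ν ?_ ?_ ?_ ?_)
  · rintro s ⟨h₁, h₂, -⟩ - hx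
    have hx1 : s.reg fl = 1 := by simp only [Expr.eval] at hx; omega
    obtain ⟨a, ha, hL, hνs, -⟩ := hν s h₁
    refine Run.assign_seq ((hP a _ (hfl a s 0 ha)).mono fun s' hs' => ?_)
    rcases hs' with ⟨a', h₃, h₄, h₅⟩ | ⟨h₃, h₄, h₅⟩
    · have hex : ∃ a, Rep a s' ∧ μ a + s'.reg fl ≤ L := ⟨a', h₃, by omega⟩
      obtain ⟨_, _, _, _, hmin⟩ := hν s' hex
      exact ⟨⟨hex, by omega, by omega⟩, by have := hmin a' h₃; omega⟩
    · have h6 : s'.reg fl = 0 := by simpa [State.setReg_reg, Expr.eval] using h₄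
      have hex : ∃ a, Rep a s' ∧ μ a + s'.reg fl ≤ L := ⟨a, h₃, by omega⟩
      obtain ⟨_, _, _, _, hmin⟩ := hν s' hex
      exact ⟨⟨hex, by omega, fun _ => ⟨a, h₃, h₅⟩⟩, by have := hmin a h₃; omega⟩
  · refine ⟨⟨a, hfl _ _ _ h0, ?_⟩, ?_, ?_⟩ <;> simp [State.setReg_reg, Expr.eval]
    omega
  · have hex : ∃ a', Rep a' (s.setReg fl 1) ∧ μ a' + (s.setReg fl 1).reg fl ≤ L :=
      ⟨a, hfl _ _ _ h0, by simp [State.setReg_reg]; omega⟩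
    obtain ⟨a', _, h₂, h₃, _⟩ := hν _ hex
    exact h₃.trans_le h₂
  · rintro s' ⟨-, -, h⟩ - hx
    obtain ⟨a, h₁, h₂⟩ := h hx
    exact hQ a s' h₁ h₂

/-- Failures recorded for `a` become worthless once `a` is replaced. The left alternative of the
invariant then drops them, and later indices only have to preserve the improvement. -/
theorem Run.scan {i b n : ℕ} {F : α → ℕ → Prop} (hi : ∀ a s c, Rep a s → Rep a (s.setReg i c))
    (hP : (P.keepsReg i && P.keepsReg b && (b != i) && (fl != i)) = true) (hn : n ≤ L)
    (hstep : ∀ j < n, ∀ a s, Rep a s → s.reg i = j →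
      Run L P s (Progress Rep μ fl s a (F a j)))
    {a : α} (h0 : Rep a s) (hb : s.reg b = n) :
    Run L (.forTo i b P) s (Progress Rep μ fl s a (∀ j < n, F a j)) := by
  rw [Bool.and_eq_true, bne_iff_ne] at hP
  obtain ⟨hP, hfl⟩ := hP
  refine Run.forTo (fun j s' => Progress Rep μ fl s a (∀ j' < j, F a j') s') hb hP hn ?_ ?_
    fun _ h => h
  · exact Or.inr ⟨hi _ _ _ h0, by simp [State.setReg_reg, hfl], by simp⟩
  · rintro j hj s₁ (⟨a', h₁, h₂, h₃⟩ | ⟨h₁, h₂, h₃⟩) hij - -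
    · refine (hstep j hj a' s₁ h₁ hij).mono fun s₂ h => Or.inl ?_
      rcases h with ⟨a'', h₄, h₅, h₆⟩ | ⟨h₄, h₅, -⟩
      · exact ⟨a'', hi _ _ _ h₄, h₅.trans h₂, by simp [State.setReg_reg, hfl, h₆]⟩
      · exact ⟨a', hi _ _ _ h₄, h₂, by simp [State.setReg_reg, hfl, h₅, h₃]⟩
    · refine (hstep j hj a s₁ h₁ hij).mono fun s₂ h => ?_
      rcases h with ⟨a'', h₄, h₅, h₆⟩ | ⟨h₄, h₅, h₆⟩
      · exact Or.inl ⟨a'', hi _ _ _ h₄, h₅, by simp [State.setReg_reg, hfl, h₆]⟩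
      · refine Or.inr ⟨hi _ _ _ h₄, by simp [State.setReg_reg, hfl, h₅, h₂], fun j' hj' => ?_⟩
        rcases Nat.lt_succ_iff_lt_or_eq.1 hj' with h | rfl
        · exact h₃ _ h
        · exact h₆

/-- Local search over pairs of indices. -/
theorem Run.search₂ {i j b c n m : ℕ} {F : α → ℕ → ℕ → Prop}
    (hreg : ∀ a s r x, r = fl ∨ r = i ∨ r = j → Rep a s → Rep a (s.setReg r x))
    (hb : ∀ a s, Rep a s → s.reg b = n) (hc : ∀ a s, Rep a s → s.reg c = m)
    (hP : (P.keepsReg i && P.keepsReg j && P.keepsReg b && P.keepsReg c &&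
      (b != i) && (b != j) && (c != i) && (c != j) && (fl != i) && (fl != j) && (i != j)) = true)
    (hn : n ≤ L) (hm : m ≤ L)
    (hstep : ∀ u < n, ∀ v < m, ∀ a s, Rep a s → s.reg i = u → s.reg j = v →
      Run L P s (Progress Rep μ fl s a (F a u v)))
    {a : α} (h0 : Rep a s) (hL : μ a < L)
    (hQ : ∀ a s', Rep a s' → (∀ u < n, ∀ v < m, F a u v) → Q s') :
    Run L (.search fl (.forTo i b (.forTo j c P))) s Q := by
  simp only [Bool.and_eq_true, bne_iff_ne] at hP
  obtain ⟨⟨⟨⟨⟨⟨⟨⟨⟨⟨h₁, h₂⟩, h₃⟩, h₄⟩, h₅⟩, h₆⟩, h₇⟩, h₈⟩, h₉⟩, h10⟩, h11⟩ := hP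
  refine Run.search (F := fun a => ∀ u < n, ∀ v < m, F a u v)
    (fun a s x => hreg a s fl x (.inl rfl)) (fun a s ha => ?_) h0 hL hQ
  refine Run.scan (F := fun a u => ∀ v < m, F a u v)
    (fun a s x => hreg a s i x (.inr (.inl rfl))) ?_ hn ?_ ha (hb _ _ ha)
  · simp [Prog.keepsReg, Prog.forTo, *, h11.symm, h₆.symm]
  intro u hu a s ha hs
  have key := Run.scan (Rep := fun a s => Rep a s ∧ s.reg i = u) (P := P) (i := j) (b := c)
    (fl := fl) (F := fun a v => F a u v) (L := L) (n := m) (μ := μ) ?_ ?_ hm ?_ ⟨ha, hs⟩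
    (hc _ _ ha)
  · refine key.mono fun s' h => ?_
    rcases h with ⟨a', h, h'⟩ | ⟨h, h'⟩
    · exact Or.inl ⟨a', h.1, h'⟩
    · exact Or.inr ⟨h.1, h'⟩
  · exact fun a s x h => ⟨hreg _ _ _ _ (.inr (.inr rfl)) h.1, by simp [State.setReg_reg, h11, h.2]⟩
  · simp [*]
  · rintro v hv a s ⟨ha, hs⟩ hs'
    refine (hstep u hu v hv a s ha hs hs').frame.mono fun s' ⟨h, hf⟩ => ?_
    have hi := (hf.reg i h₁).trans hs
    rcases h with ⟨a', h, h'⟩ | ⟨h, h'⟩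
    · exact Or.inl ⟨a', ⟨h, hi⟩, h'⟩
    · exact Or.inr ⟨⟨h, hi⟩, h'⟩

end Search

/-- An expression that is non-zero if and only if the values of `x` and `y` are different. -/
def Expr.ne (x y : Expr) : Expr := .add (.sub x y) (.sub y x)

theorem Expr.eval_ne {x y : Expr} {s : State} : (Expr.ne x y).eval s = 0 ↔ x.eval s = y.eval s := by
  simp only [Expr.ne, Expr.eval]; omega

end Ram

namespace KTrail

/-! ### Orientations and tight sets -/

open Finset

/-- Directed edges: edge `e` goes from `src e` to `dst e`. -/
structure Arcs where
  /-- the tails of the edges -/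
  src : ℕ → ℕ
  /-- the heads of the edges -/
  dst : ℕ → ℕ

namespace Arcs

variable (D : Arcs) (m : ℕ)

/-- The number of edges among the first `m` with head `v`. -/
def indeg (v : ℕ) : ℕ := #{e ∈ range m | D.dst e = v}

/-- The degree of `v`, loops being counted twice. -/
def deg (v : ℕ) : ℕ := #{e ∈ range m | D.src e = v} + D.indeg m v

/-- The number of copies of `v` in a tree with root over `0` which is oriented as `D`. -/
def copies (v : ℕ) : ℕ := D.indeg m v + if v = 0 then 1 else 0

/-- The number of edges entering `X`. -/
def enter (X : Finset ℕ) : ℕ := #{e ∈ range m | D.src e ∉ X ∧ D.dst e ∈ X}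

/-- The number of edges inside `X`. -/
def inner (X : Finset ℕ) : ℕ := #{e ∈ range m | D.src e ∈ X ∧ D.dst e ∈ X}

/-- Reachability by directed paths. -/
def Reach : ℕ → ℕ → Prop :=
  Relation.ReflTransGen fun x y => ∃ e < m, D.src e = x ∧ D.dst e = y

/-- All vertices are reachable from the vertex `0`. -/
def Rooted (n : ℕ) : Prop := ∀ x < n, D.Reach m 0 x

/-- As few edges as possible enter `X` if all vertices are to be reachable from `0`. -/
def Tight (X : Finset ℕ) : Prop := D.enter m X = if 0 ∈ X then 0 else 1

/-- The same edges, up to orientation. -/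
def Same (D' : Arcs) : Prop := ∀ e < m, s(D.src e, D.dst e) = s(D'.src e, D'.dst e)

variable {D m}

theorem Same.refl : D.Same m D := fun _ _ => rfl

theorem Same.trans {D' D'' : Arcs} (h : D.Same m D') (h' : D'.Same m D'') : D.Same m D'' :=
  fun e he => (h e he).trans (h' e he)

theorem Same.inner_eq {D' : Arcs} (h : D.Same m D') (X : Finset ℕ) :
    D.inner m X = D'.inner m X := by
  unfold inner
  congr 1
  refine filter_congr fun e he => ?_
  have := h e (mem_range.1 he)
  rw [Sym2.eq_iff] at this
  rcases this with ⟨h₁, h₂⟩ | ⟨h₁, h₂⟩ <;> rw [h₁, h₂]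
  exact and_comm

theorem Same.deg_eq {D' : Arcs} (h : D.Same m D') (v : ℕ) : D.deg m v = D'.deg m v := by
  simp only [deg, indeg, card_filter, ← sum_add_distrib]
  refine sum_congr rfl fun e he => ?_
  have := h e (mem_range.1 he)
  rw [Sym2.eq_iff] at this
  rcases this with ⟨h₁, h₂⟩ | ⟨h₁, h₂⟩ <;> rw [h₁, h₂]
  exact add_comm _ _

theorem sum_indeg (X : Finset ℕ) : ∑ v ∈ X, D.indeg m v = D.enter m X + D.inner m X := by
  have h₁ : ∑ v ∈ X, D.indeg m v = #{e ∈ range m | D.dst e ∈ X} := by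
    rw [card_eq_sum_card_fiberwise (f := D.dst) (t := X) (fun e he => by simp_all)]
    refine sum_congr rfl fun v hv => ?_
    rw [indeg, filter_filter]
    congr 1
    refine filter_congr fun e _ => ?_
    aesop
  rw [h₁, ← card_filter_add_card_filter_not (s := {e ∈ range m | D.dst e ∈ X})
    (fun e => D.src e ∈ X), filter_filter, filter_filter, add_comm]
  simp only [enter, inner, and_comm]

/-- Submodularity of the cut function. It holds for each edge separately, by the position of its two
ends. -/
theorem enter_union_add_enter_inter (X Y : Finset ℕ) :
    D.enter m (X ∪ Y) + D.enter m (X ∩ Y) ≤ D.enter m X + D.enter m Y := by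
  simp only [enter, card_filter, ← sum_add_distrib]
  refine sum_le_sum fun e _ => ?_
  by_cases h₁ : D.src e ∈ X <;> by_cases h₂ : D.src e ∈ Y <;> by_cases h₃ : D.dst e ∈ X <;>
    by_cases h₄ : D.dst e ∈ Y <;> simp [h₁, h₂, h₃, h₄]

theorem Reach.exists_enter {X : Finset ℕ} {a b : ℕ} (h : D.Reach m a b) (ha : a ∉ X)
    (hb : b ∈ X) : 1 ≤ D.enter m X := by
  induction h with
  | refl => exact absurd hb ha
  | @tail c d _ hcd ih =>
    obtain ⟨e, he, rfl, rfl⟩ := hcd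
    by_cases hc : D.src e ∈ X
    · exact ih hc
    · exact card_pos.2 ⟨e, by simp [he, hc, hb]⟩

theorem Rooted.le_enter {n : ℕ} (h : D.Rooted m n) {X : Finset ℕ} (hX : X ⊆ range n)
    (hne : X.Nonempty) : (if 0 ∈ X then 0 else 1) ≤ D.enter m X := by
  split_ifs with h0
  · exact Nat.zero_le _
  · obtain ⟨x, hx⟩ := hne
    exact (h x (mem_range.1 (hX hx))).exists_enter h0 hx

/-- Uncrossing: the lower bounds on `enter` for the union and the intersection add up to those for
`X` and `Y`, so submodularity forces equality. The intersection has to be non-empty for its bound to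
hold. -/
theorem Tight.union {n : ℕ} (h : D.Rooted m n) {X Y : Finset ℕ} (hX : X ⊆ range n)
    (hY : Y ⊆ range n) (hXY : (X ∩ Y).Nonempty) (hX' : D.Tight m X) (hY' : D.Tight m Y) :
    D.Tight m (X ∪ Y) := by
  have h₁ := h.le_enter (union_subset hX hY) (hXY.mono (inter_subset_left.trans subset_union_left))
  have h₂ := h.le_enter (inter_subset_left.trans hX) hXY
  have h₃ := enter_union_add_enter_inter (D := D) (m := m) X Y
  unfold Tight at *
  rw [hX', hY'] at h₃
  simp only [mem_union, mem_inter] at *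
  by_cases h₄ : 0 ∈ X <;> by_cases h₅ : 0 ∈ Y <;> simp [h₄, h₅] at * <;> omega

end Arcs

/-- A connected multigraph has at most one more vertex than it has edges that are not loops. -/
theorem card_le_card_ne_add_one {A : Type*} [Fintype A] [DecidableEq A] [Nonempty A] {m : ℕ}
    (p q : ℕ → A)
    (h : ∀ S : Set A, S.Nonempty → (∀ e < m, p e ∈ S ↔ q e ∈ S) → S = Set.univ) :
    Fintype.card A ≤ #{e ∈ range m | p e ≠ q e} + 1 := by
  let G : SimpleGraph A := SimpleGraph.fromRel fun a b => ∃ e < m, p e = a ∧ q e = b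
  have hc : G.Connected := by
    refine ⟨fun a b => ?_⟩
    have := h {b | G.Reachable a b} ⟨a, .refl _⟩ fun e he => ?_
    · exact Set.eq_univ_iff_forall.1 this b
    · by_cases hpq : p e = q e
      · rw [hpq]
      · have hadj : G.Adj (p e) (q e) := by
          rw [SimpleGraph.fromRel_adj]; exact ⟨hpq, .inl ⟨e, he, rfl, rfl⟩⟩
        exact ⟨fun h => h.trans hadj.reachable, fun h => h.trans hadj.symm.reachable⟩
  have h₁ := hc.card_vert_le_card_edgeSet_add_one
  rw [Nat.card_eq_fintype_card] at h₁
  refine h₁.trans (Nat.add_le_add_right ?_ 1)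
  have hsub : G.edgeSet ⊆ ({e ∈ range m | p e ≠ q e}.image fun e => s(p e, q e) :
      Finset (Sym2 A)) := by
    intro z
    induction z with
    | h a b =>
      rw [SimpleGraph.mem_edgeSet, SimpleGraph.fromRel_adj]
      rintro ⟨hab, ⟨e, he, rfl, rfl⟩ | ⟨e, he, rfl, rfl⟩⟩
      · exact mem_coe.2 (mem_image.2 ⟨e, by simp [he, hab], rfl⟩)
      · exact mem_coe.2 (mem_image.2 ⟨e, by simp [he, hab.symm], Sym2.eq_swap⟩)
  calc Nat.card G.edgeSet = G.edgeSet.ncard := rfl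
    _ ≤ _ := Set.ncard_le_ncard hsub (finite_toSet _)
    _ ≤ _ := by rw [Set.ncard_coe_finset]; exact card_image_le

/-! ### The obstruction: contracting maximal tight sets -/

namespace Arcs

variable {D : Arcs} {n m k v : ℕ} {W : Type*} [Fintype W] [DecidableEq W] {x y : ℕ → W} {φ : W → ℕ}

/-- The degree of `u` is the sum of the degrees of its copies. -/
theorem deg_le_mul_card_fiber (hsym : ∀ e < m, s(φ (x e), φ (y e)) = s(D.src e, D.dst e))
    (hdeg : ∀ w, #{e ∈ range m | x e = w} + #{e ∈ range m | y e = w} ≤ k) (u : ℕ) :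
    D.deg m u ≤ k * #{w | φ w = u} := by
  have h₁ : D.deg m u = Arcs.deg ⟨φ ∘ x, φ ∘ y⟩ m u := Same.deg_eq (fun e he => (hsym e he).symm) u
  have h₂ : ∀ z : ℕ → W, #{e ∈ range m | φ (z e) = u} =
      ∑ w with φ w = u, #{e ∈ range m | z e = w} := by
    intro z
    rw [card_eq_sum_card_fiberwise (f := z) (t := ({w | φ w = u} : Finset W))
      (fun e he => by simp_all)]
    refine sum_congr rfl fun w hw => ?_
    rw [filter_filter]
    congr 1
    refine filter_congr fun e _ => ?_
    have := (mem_filter.1 hw).2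
    constructor
    · exact fun h => h.2
    · rintro rfl
      exact ⟨this, rfl⟩
  rw [h₁, deg, indeg]
  simp only [Function.comp]
  rw [h₂ x, h₂ y, ← sum_add_distrib, mul_comm]
  exact sum_le_card_nsmul _ _ _ fun w _ => hdeg w

/-- If no copy of another vertex can be traded for a copy of the vertex `v`, which has too few of
them, then there is no connected multigraph of maximum degree at most `k` over `D`. -/
theorem false_of_stuck (hval : ∀ e < m, D.src e < n ∧ D.dst e < n) (hroot : D.Rooted m n)
    (hv : v < n) (hdef : k * D.copies m v < D.deg m v)
    (hstuck : ∀ u < n, D.deg m u + k ≤ k * D.copies m u →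
      ∃ X ⊆ range n, D.Tight m X ∧ u ∈ X ∧ v ∉ X)
    (hφ : ∀ w, φ w < n) (honto : ∀ u < n, ∃ w, φ w = u)
    (hsym : ∀ e < m, s(φ (x e), φ (y e)) = s(D.src e, D.dst e))
    (hconn : ∀ S : Set W, S.Nonempty → (∀ e < m, x e ∈ S ↔ y e ∈ S) → S = Set.univ)
    (hdeg : ∀ w, #{e ∈ range m | x e = w} + #{e ∈ range m | y e = w} ≤ k) : False := by
  classical
  let P : Finset ℕ → Prop := fun X => D.Tight m X ∧ v ∉ X ∧ X.Nonempty
  let 𝒯 : Finset (Finset ℕ) := (range n).powerset.filter P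
  -- The maximal tight sets avoiding `v`. The union of two that meet is again tight and avoids `v`,
  -- so distinct ones are disjoint.
  let 𝓕 : Finset (Finset ℕ) := 𝒯.filter fun X => ∀ Y ∈ 𝒯, X ⊆ Y → X = Y
  have h𝒯 : ∀ X, X ∈ 𝒯 ↔ X ⊆ range n ∧ D.Tight m X ∧ v ∉ X ∧ X.Nonempty := by
    intro X; simp [𝒯, P]
  have h𝓕𝒯 : ∀ X ∈ 𝓕, X ∈ 𝒯 := fun X hX => (mem_filter.1 hX).1
  have hdisj : ∀ X ∈ 𝓕, ∀ Y ∈ 𝓕, ∀ u, u ∈ X → u ∈ Y → X = Y := by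
    intro X hX Y hY u hu hu'
    obtain ⟨h₁, h₂, h₃, h₄⟩ := (h𝒯 X).1 (h𝓕𝒯 X hX)
    obtain ⟨h₅, h₆, h₇, h₈⟩ := (h𝒯 Y).1 (h𝓕𝒯 Y hY)
    have hU : X ∪ Y ∈ 𝒯 := (h𝒯 _).2 ⟨union_subset h₁ h₅,
      h₂.union hroot h₁ h₅ ⟨u, mem_inter.2 ⟨hu, hu'⟩⟩ h₆, by simp [h₃, h₇],
      h₄.mono subset_union_left⟩
    exact ((mem_filter.1 hX).2 _ hU subset_union_left).trans
      ((mem_filter.1 hY).2 _ hU subset_union_right).symm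
  have hcover : ∀ X ∈ 𝒯, ∃ Y ∈ 𝓕, X ⊆ Y := by
    intro X hX
    obtain ⟨Y, hXY, hY⟩ := 𝒯.exists_le_maximal hX
    exact ⟨Y, mem_filter.2 ⟨hY.1, fun Z hZ hYZ => le_antisymm hYZ (hY.2 hZ hYZ)⟩, hXY⟩
  have hpd : (𝓕 : Set (Finset ℕ)).PairwiseDisjoint id := by
    intro X hX Y hY hne
    rw [Function.onFun, Finset.disjoint_left]
    exact fun u hu hu' => hne (hdisj X hX Y hY u hu hu')
  let Z : Finset ℕ := 𝓕.biUnion id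
  have hmemZ : ∀ u, u ∈ Z ↔ ∃ X ∈ 𝓕, u ∈ X := by simp [Z]
  have hZn : Z ⊆ range n := fun u hu => by
    obtain ⟨X, hX, hu⟩ := (hmemZ u).1 hu
    exact ((h𝒯 X).1 (h𝓕𝒯 X hX)).1 hu
  have hvZ : v ∉ Z := fun hu => by
    obtain ⟨X, hX, hu⟩ := (hmemZ v).1 hu
    exact ((h𝒯 X).1 (h𝓕𝒯 X hX)).2.2.1 hu
  let c : ℕ → ℕ := fun u => #{w | φ w = u}
  let Y : Finset ℕ := range n \ Z
  have hd : ∀ u, D.deg m u ≤ k * c u := deg_le_mul_card_fiber hsym hdeg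
  -- counting copies
  have hlt : ∑ u ∈ Y, D.copies m u < ∑ u ∈ Y, c u := by
    refine sum_lt_sum (fun u hu => ?_) ⟨v, by simp [Y, hv, hvZ], ?_⟩
    · obtain ⟨hu, huZ⟩ := mem_sdiff.1 hu
      have hns : ¬ D.deg m u + k ≤ k * D.copies m u := fun hns => by
        obtain ⟨X, h₁, h₂, h₃, h₄⟩ := hstuck u (mem_range.1 hu) hns
        obtain ⟨X', hX', hXX'⟩ := hcover X ((h𝒯 X).2 ⟨h₁, h₂, h₄, u, h₃⟩)
        exact huZ ((hmemZ u).2 ⟨X', hX', hXX' h₃⟩)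
      -- Outside the tight sets no vertex can spare a copy, so k · copies u < deg u + k ≤ k · (c u +
      -- 1).
      have h₁ : k * D.copies m u < k * (c u + 1) := by have := hd u; rw [mul_add]; omega
      exact Nat.lt_succ_iff.1 (Nat.lt_of_mul_lt_mul_left h₁)
    · exact Nat.lt_of_mul_lt_mul_left (hdef.trans_le (hd v))
  have hn0 : 0 < n := (Nat.zero_le _).trans_lt hv
  have hm : ∑ u ∈ range n, D.indeg m u = m := by
    rw [sum_indeg, enter, inner, filter_false_of_mem, filter_true_of_mem] <;>
      simp +contextual [hval]
  have hsplit : ∀ f : ℕ → ℕ, ∑ u ∈ Y, f u + ∑ X ∈ 𝓕, ∑ u ∈ X, f u = ∑ u ∈ range n, f u := by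
    intro f
    rw [← sum_sdiff hZn, sum_biUnion hpd]; rfl
  have hcop : ∑ u ∈ range n, D.copies m u = m + 1 := by
    simp [copies, sum_add_distrib, hm, hn0]
  -- If 0 ∈ X, no edge enters but the root counts as a copy; otherwise exactly one edge enters.
  -- Either way there is one copy beyond the inner edges.
  have htight : ∀ X ∈ 𝓕, ∑ u ∈ X, D.copies m u = D.inner m X + 1 := by
    intro X hX
    have := ((h𝒯 X).1 (h𝓕𝒯 X hX)).2.1
    unfold Tight at this
    simp only [copies, sum_add_distrib, sum_indeg, this, sum_ite_eq']
    split_ifs <;> omega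
  -- contract the sets in `𝓕`
  have hin : ∑ X ∈ 𝓕, D.inner m X ≤ m := by
    have h₁ := hsplit (D.copies m)
    have h₂ := hsplit (D.indeg m)
    have h₃ : ∑ X ∈ 𝓕, D.inner m X ≤ ∑ X ∈ 𝓕, ∑ u ∈ X, D.indeg m u :=
      sum_le_sum fun X _ => by rw [sum_indeg]; omega
    omega
  choose! cls hcls hucls using fun u (hu : u ∈ Z) => (hmemZ u).1 hu
  -- The vertices of the contracted graph: copies outside `Z` survive, and all copies of all
  -- vertices of a set in `𝓕` become one vertex.
  let A := {w : W // φ w ∉ Z} ⊕ 𝓕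
  let ψ : W → A := fun w => if h : φ w ∈ Z then .inr ⟨cls (φ w), hcls _ h⟩ else .inl ⟨w, h⟩
  have hψX : ∀ X (hX : X ∈ 𝓕) w, φ w ∈ X → ψ w = .inr ⟨X, hX⟩ := by
    intro X hX w hw
    have hwZ : φ w ∈ Z := (hmemZ _).2 ⟨X, hX, hw⟩
    exact (dif_pos hwZ).trans (congrArg Sum.inr (Subtype.ext
      (hdisj _ (hcls _ hwZ) _ hX _ (hucls _ hwZ) hw)))
  have hψ : Function.Surjective ψ := by
    rintro (⟨w, hw⟩ | ⟨X, hX⟩)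
    · exact ⟨w, by simp [ψ, hw]⟩
    · obtain ⟨hXn, -, -, u, hu⟩ := (h𝒯 X).1 (h𝓕𝒯 X hX)
      obtain ⟨w, rfl⟩ := honto u (mem_range.1 (hXn hu))
      exact ⟨w, hψX X hX w hu⟩
  obtain ⟨w0, -⟩ := honto v hv
  have : Nonempty A := ⟨ψ w0⟩
  have hcard := card_le_card_ne_add_one (m := m) (ψ ∘ x) (ψ ∘ y) fun S hS hS' => by
    have h₁ := hconn (ψ ⁻¹' S) (hS.preimage hψ) hS'
    exact Set.eq_univ_of_forall fun a => by
      obtain ⟨w, rfl⟩ := hψ a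
      have : w ∈ ψ ⁻¹' S := h₁ ▸ Set.mem_univ w
      exact this
  have hA : Fintype.card A = ∑ u ∈ Y, c u + #𝓕 := by
    rw [Fintype.card_sum, Fintype.card_coe, Fintype.card_subtype]
    congr 1
    rw [card_eq_sum_card_fiberwise (f := φ) (t := Y) (fun w hw => by
      have : φ w ∉ Z := by simpa using hw
      simp [Y, hφ, this])]
    refine sum_congr rfl fun u hu => ?_
    rw [filter_filter]
    refine congrArg card (filter_congr fun w _ => ?_)
    have := (mem_sdiff.1 hu).2
    exact ⟨fun h => h.2, fun h => ⟨h ▸ this, h⟩⟩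
  -- An edge inside a set of `𝓕` becomes a loop, so it does not help to connect the contracted
  -- graph.
  have hedges : #{e ∈ range m | (ψ ∘ x) e ≠ (ψ ∘ y) e} + ∑ X ∈ 𝓕, D.inner m X ≤ m := by
    have h₁ : ∑ X ∈ 𝓕, D.inner m X =
        #(𝓕.biUnion fun X => {e ∈ range m | D.src e ∈ X ∧ D.dst e ∈ X}) := by
      rw [card_biUnion]
      · rfl
      · intro X hX X' hX' hne
        rw [Function.onFun, Finset.disjoint_left]
        intro e he he'
        exact hne (hdisj X hX X' hX' _ (mem_filter.1 he).2.1 (mem_filter.1 he').2.1)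
    rw [h₁, ← card_union_of_disjoint]
    · refine (card_le_card (t := range m) ?_).trans_eq (card_range m)
      intro e he
      simp only [mem_union, mem_filter, mem_biUnion] at he
      rcases he with h | ⟨_, _, h⟩ <;> exact h.1
    · rw [Finset.disjoint_left]
      intro e he he'
      obtain ⟨X, hX, he'⟩ := mem_biUnion.1 he'
      obtain ⟨hem, h₂, h₃⟩ := mem_filter.1 he'
      refine (mem_filter.1 he).2 ?_
      have hmem : φ (x e) ∈ X ∧ φ (y e) ∈ X := by
        have := hsym e (mem_range.1 hem)
        rw [Sym2.eq_iff] at this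
        rcases this with ⟨h₄, h₅⟩ | ⟨h₄, h₅⟩ <;> rw [h₄, h₅] <;>
          exact ⟨by assumption, by assumption⟩
      exact (hψX X hX _ hmem.1).trans (hψX X hX _ hmem.2).symm
  -- The orientation satisfies ∑ copies + ∑ inner + #𝓕 = m + 1, while connectedness gives ∑ c + ∑
  -- inner + #𝓕 ≤ m + 1; this contradicts `hlt`.
  have h₁ := hsplit (D.copies m)
  rw [sum_congr rfl htight, sum_add_distrib, hcop, sum_const, smul_eq_mul, mul_one] at h₁
  omega

end Arcs

end KTrail

namespace KTrail

/-! ### From multigraphs to numbered edges and back -/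

open Finset

/-- The edges of a multigraph, oriented as they are listed. -/
def EdgeList.arcs (G : EdgeList) : Arcs where
  src e := if h : e < G.m then (G.ends ⟨e, h⟩).1 else 0
  dst e := if h : e < G.m then (G.ends ⟨e, h⟩).2 else 0

theorem EdgeList.arcs_lt (G : EdgeList) {e : ℕ} (he : e < G.m) :
    G.arcs.src e < G.n ∧ G.arcs.dst e < G.n := by
  simp [arcs, he]

theorem Arcs.Same.lt {D D' : Arcs} {m n : ℕ} (h : D.Same m D')
    (hval : ∀ e < m, D'.src e < n ∧ D'.dst e < n) : ∀ e < m, D.src e < n ∧ D.dst e < n := by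
  intro e he
  have h₁ := h e he
  have h₂ := hval e he
  rw [Sym2.eq_iff] at h₁
  rcases h₁ with ⟨h₃, h₄⟩ | ⟨h₃, h₄⟩ <;> rw [h₃, h₄]
  · exact h₂
  · exact h₂.symm

theorem ncard_setOf_fin {m : ℕ} (p : ℕ → Prop) [DecidablePred p] :
    {e : Fin m | p e}.ncard = #{e ∈ range m | p e} := by
  rw [← Set.ncard_coe_finset, ← Set.ncard_image_of_injective _ Fin.val_injective]
  congr 1
  ext e
  simp only [Set.mem_image, Set.mem_ofPred_eq, coe_filter, mem_range]
  exact ⟨fun ⟨f, hf, h⟩ => h ▸ ⟨f.2, hf⟩, fun ⟨h₁, h₂⟩ => ⟨⟨e, h₁⟩, h₂, rfl⟩⟩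

/-- A set of vertices of a connected graph that is closed under adjacency contains all vertices. -/
theorem IsConnected.mem_of_closed {α β : Type*} {G : Graph α β} (h : IsConnected G)
    {S : Set α} (hne : ∃ a ∈ G.vertexSet, a ∈ S)
    (hS : ∀ e u v, G.IsLink e u v → u ∈ S → v ∈ S) {b : α} (hb : b ∈ G.vertexSet) : b ∈ S := by
  obtain ⟨a, ha, haS⟩ := hne
  obtain ⟨p⟩ := h.preconnected ⟨a, ha⟩ ⟨b, hb⟩
  suffices ∀ u v : G.vertexSet, G.toSimpleGraph.Walk u v → u.1 ∈ S → v.1 ∈ S from this _ _ p haS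
  intro u v p
  induction p with
  | nil => exact id
  | cons hadj _ ih =>
    obtain ⟨-, e, he⟩ := hadj
    exact fun hu => ih (hS e _ _ he hu)

theorem EdgeList.mem_of_closed {G : EdgeList} (h : IsConnected G.toGraph) {D : Arcs}
    (hD : D.Same G.m G.arcs) {S : Set ℕ} {a : ℕ} (ha : a < G.n) (haS : a ∈ S)
    (hS : ∀ e < G.m, D.src e ∈ S ↔ D.dst e ∈ S) {b : ℕ} (hb : b < G.n) : b ∈ S := by
  refine IsConnected.mem_of_closed h (S := {u : Fin G.n | u.1 ∈ S}) ⟨⟨a, ha⟩, trivial, haS⟩ ?_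
    (b := ⟨b, hb⟩) trivial
  intro e u v he
  have h₁ := hS e e.2
  have h₂ := hD e e.2
  have h₃ : s((G.ends e).1, (G.ends e).2) = s(u, v) := he
  simp only [arcs, e.2, dite_true] at h₂
  rw [Sym2.eq_iff] at h₂ h₃
  rcases h₂ with ⟨h₄, h₅⟩ | ⟨h₄, h₅⟩ <;> rcases h₃ with ⟨rfl, rfl⟩ | ⟨rfl, rfl⟩ <;>
    rw [h₄, h₅] at h₁ <;> simp [h₁]

/-- The edges of a multigraph and of its homomorphic image correspond. -/
theorem IsHomImageBy.exists_equiv {G : EdgeList} {γ δ : Type*} {H : Graph γ δ}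
    {φ : γ → Fin G.n} (h : IsHomImageBy G.toGraph H φ) (hE : H.edgeSet.Finite) :
    ∃ (σ : Fin G.m ≃ H.edgeSet) (x y : Fin G.m → γ), ∀ e, H.IsLink (σ e) (x e) (y e) ∧
      s(φ (x e), φ (y e)) = s((G.ends e).1, (G.ends e).2) := by
  choose X Y hXY using fun f : H.edgeSet => H.exists_isLink_of_mem_edgeSet f.2
  have := hE.to_subtype
  -- Equal numbers of edges over each pair `z` give a bijection between the fibres over `z`; glued
  -- together, these bijections form `σ`.
  have hfib : ∀ z : Sym2 (Fin G.n), Nonempty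
      ({e : Fin G.m // s((G.ends e).1, (G.ends e).2) = z} ≃
        {f : H.edgeSet // s(φ (X f), φ (Y f)) = z}) := by
    intro z
    induction z with
    | h u v =>
      have h₁ := h.ncard_eq u trivial v trivial
      refine Finite.card_eq.1 (h₁.trans ?_)
      have hiff : ∀ f (hf : f ∈ H.edgeSet), (∃ x y, H.IsLink f x y ∧ s(φ x, φ y) = s(u, v)) ↔
          s(φ (X ⟨f, hf⟩), φ (Y ⟨f, hf⟩)) = s(u, v) := by
        refine fun f hf => ⟨fun ⟨x, y, hl, hs⟩ => ?_, fun h => ⟨_, _, hXY ⟨f, hf⟩, h⟩⟩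
        rcases (hXY ⟨f, hf⟩).eq_and_eq_or_eq_and_eq hl with ⟨h₂, h₃⟩ | ⟨h₂, h₃⟩ <;> rw [h₂, h₃]
        · exact hs
        · exact Sym2.eq_swap.trans hs
      have hmem : ∀ f, (∃ x y, H.IsLink f x y ∧ s(φ x, φ y) = s(u, v)) → f ∈ H.edgeSet :=
        fun f ⟨_, _, hl, _⟩ => hl.edge_mem
      exact Nat.card_congr ⟨fun f => ⟨⟨f.1, hmem f.1 f.2⟩, (hiff f.1 _).1 f.2⟩,
        fun f => ⟨f.1.1, (hiff f.1.1 f.1.2).2 f.2⟩, fun f => rfl, fun f => rfl⟩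
  let σ : Fin G.m ≃ H.edgeSet := Equiv.ofFiberEquiv fun z => (hfib z).some
  exact ⟨σ, X ∘ σ, Y ∘ σ, fun e => ⟨hXY _, Equiv.ofFiberEquiv_map
    (f := fun e => s((G.ends e).1, (G.ends e).2)) (g := fun f => s(φ (X f), φ (Y f))) _ e⟩⟩

/-- Numbering the edges of `H` by those of `G` puts `H` into the form required by
`Arcs.false_of_stuck`. -/
theorem not_isKTrail_of_stuck {G : EdgeList} {k v : ℕ} {D : Arcs} (hD : D.Same G.m G.arcs)
    (hroot : D.Rooted G.m G.n) (hv : v < G.n) (hdef : k * D.copies G.m v < D.deg G.m v)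
    (hstuck : ∀ u < G.n, D.deg G.m u + k ≤ k * D.copies G.m u →
      ∃ X ⊆ range G.n, D.Tight G.m X ∧ u ∈ X ∧ v ∉ X) : ¬ IsKTrail G.toGraph k := by
  classical
  rintro ⟨γ, δ, H, φ, hVf, hEf, hconn, hmax, hhom⟩
  obtain ⟨σ, x, y, hσ⟩ := hhom.exists_equiv hEf
  have := hVf.to_subtype
  have := Fintype.ofFinite H.vertexSet
  obtain ⟨w0⟩ : Nonempty H.vertexSet := hconn.nonempty
  let x' : ℕ → H.vertexSet := fun e => if h : e < G.m then ⟨x ⟨e, h⟩, (hσ _).1.left_mem⟩ else w0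
  let y' : ℕ → H.vertexSet := fun e => if h : e < G.m then ⟨y ⟨e, h⟩, (hσ _).1.right_mem⟩ else w0
  have hx' : ∀ e : Fin G.m, (x' e : γ) = x e := fun e => by simp [x']
  have hy' : ∀ e : Fin G.m, (y' e : γ) = y e := fun e => by simp [y']
  refine Arcs.false_of_stuck (W := H.vertexSet) (x := x') (y := y') (φ := fun w => φ w.1)
    (hD.lt fun e => G.arcs_lt) hroot hv hdef hstuck (fun w => (φ w.1).2) ?_ ?_ ?_ ?_
  · intro u hu
    have : (⟨u, hu⟩ : Fin G.n) ∈ φ '' H.vertexSet := hhom.image_eq ▸ trivial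
    obtain ⟨w, hw, hwu⟩ := this
    exact ⟨⟨w, hw⟩, by rw [hwu]⟩
  · intro e he
    rw [hD e he]
    have := congrArg (Sym2.map Fin.val) (hσ ⟨e, he⟩).2
    simpa [x', y', he, EdgeList.arcs] using this
  · rintro S ⟨a, ha⟩ hS
    refine Set.eq_univ_of_forall fun b => ?_
    have := IsConnected.mem_of_closed hconn (S := Subtype.val '' S) ⟨a, a.2, a, ha, rfl⟩ ?_ b.2
    · obtain ⟨b', hb', h⟩ := this
      exact Subtype.ext h ▸ hb'
    · rintro f _ v hf ⟨u, hu, rfl⟩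
      obtain ⟨e, he⟩ := σ.surjective ⟨f, hf.edge_mem⟩
      have h₁ := (hσ e).1
      rw [he] at h₁
      have h₂ := hS e e.2
      refine ⟨⟨v, hf.right_mem⟩, ?_, rfl⟩
      rcases hf.eq_and_eq_or_eq_and_eq h₁ with ⟨h₃, h₄⟩ | ⟨h₃, h₄⟩
      · have h₅ : x' e = u := Subtype.ext ((hx' e).trans h₃.symm)
        have h₆ : y' e = ⟨v, hf.right_mem⟩ := Subtype.ext ((hy' e).trans h₄.symm)
        rw [h₅, h₆] at h₂
        exact h₂.1 hu
      · have h₅ : x' e = ⟨v, hf.right_mem⟩ := Subtype.ext ((hx' e).trans h₄.symm)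
        have h₆ : y' e = u := Subtype.ext ((hy' e).trans h₃.symm)
        rw [h₅, h₆] at h₂
        exact h₂.2 hu
  · intro w
    have key : ∀ (p : ℕ → Prop) [DecidablePred p] (S : Set δ), S ⊆ H.edgeSet →
        (∀ e : Fin G.m, p e → (σ e : δ) ∈ S) → #{e ∈ range G.m | p e} ≤ S.ncard := by
      intro p _ S hSE hS
      rw [← ncard_setOf_fin]
      exact Set.ncard_le_ncard_of_injOn (fun e => (σ e : δ)) hS
        (Subtype.val_injective.comp σ.injective).injOn (hEf.subset hSE)
    refine le_trans ?_ (hmax w w.2)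
    -- Edges with some end at `w`, plus edges with both ends at `w`: this is how `degree` counts
    -- loops twice.
    rw [← card_union_add_card_inter, ← filter_or, ← filter_and]
    refine add_le_add (key _ _ (fun f hf => hf.edge_mem) ?_) (key _ _ (fun f hf => hf.edge_mem) ?_)
    · rintro e (he | he)
      · exact ⟨y e, by rw [← he, hx']; exact (hσ e).1⟩
      · exact ⟨x e, by rw [← he, hy']; exact (hσ e).1.symm⟩
    · rintro e ⟨he, he'⟩
      have := (hσ e).1
      rw [← hx', ← hy', he, he'] at this
      exact this

/-! ### Trees given by the predecessor of every edge -/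

/-- The parent of a vertex in the graph in which edge `e` joins `π e` to its child `e + 1`. -/
def parent (π : ℕ → ℕ) : ℕ → ℕ
  | 0 => 0
  | e + 1 => π e

/-- From each of the vertices `0, …, m` one gets to the root `0`. -/
structure IsRootedTree (m : ℕ) (π : ℕ → ℕ) : Prop where
  le : ∀ e < m, π e ≤ m
  reach : ∀ w ≤ m, ∃ t, (parent π)^[t] w = 0

theorem parent_succ (π : ℕ → ℕ) (e : ℕ) : parent π (e + 1) = π e := rfl

theorem parent_iterate_zero (π : ℕ → ℕ) (t : ℕ) : (parent π)^[t] 0 = 0 :=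
  Function.iterate_fixed rfl t

theorem IsRootedTree.parent_le {m : ℕ} {π : ℕ → ℕ} (h : IsRootedTree m π) {w : ℕ} (hw : w ≤ m) :
    parent π w ≤ m := by
  cases w with
  | zero => exact hw
  | succ e => exact h.le e hw

theorem IsRootedTree.iterate_le {m : ℕ} {π : ℕ → ℕ} (h : IsRootedTree m π) {w : ℕ} (hw : w ≤ m)
    (t : ℕ) : (parent π)^[t] w ≤ m := by
  induction t with
  | zero => exact hw
  | succ t ih => rw [Function.iterate_succ_apply']; exact h.parent_le ih

/-- A periodic vertex recurs after arbitrarily long climbs, but a long climb ends at the root, which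
is fixed. This excludes all directed cycles. -/
theorem IsRootedTree.eq_zero_of_periodic {m : ℕ} {π : ℕ → ℕ} (h : IsRootedTree m π) {w t : ℕ}
    (hw : w ≤ m) (ht : 0 < t) (hwt : (parent π)^[t] w = w) : w = 0 := by
  obtain ⟨u, hu⟩ := h.reach w hw
  have h₁ : (parent π)^[t * u] w = w := Function.IsPeriodicPt.mul_const hwt u
  have h₂ : t * u = (t * u - u) + u := (Nat.sub_add_cancel (Nat.le_mul_of_pos_left u ht)).symm
  rw [h₂, Function.iterate_add_apply, hu, parent_iterate_zero] at h₁
  exact h₁.symm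

/-- The multigraph in which edge `e` joins `π e` to `e + 1`. -/
def treeEdgeList (m : ℕ) (π : ℕ → ℕ) (h : ∀ e < m, π e ≤ m) : EdgeList where
  n := m + 1
  m := m
  ends e := (⟨π e, Nat.lt_succ_of_le (h e e.2)⟩, e.succ)

/-- Climbing to the root shows connectedness; being a tree then follows by counting `m + 1` vertices
against at most `m` edges. -/
theorem IsRootedTree.isKTree {m k : ℕ} {π : ℕ → ℕ} (h : IsRootedTree m π)
    (hdeg : ∀ w ≤ m, Arcs.deg ⟨π, fun e => e + 1⟩ m w ≤ k) :
    IsKTree (treeEdgeList m π h.le).toGraph k := by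
  have hlink : ∀ (e : Fin m) (x y : Fin (m + 1)), (treeEdgeList m π h.le).toGraph.IsLink e x y ↔
      (π e = x ∧ e + 1 = (y : ℕ)) ∨ (π e = y ∧ e + 1 = (x : ℕ)) := by
    intro e x y
    refine (Sym2.eq_iff).trans ?_
    simp only [treeEdgeList, Fin.ext_iff, Fin.val_succ]
  have hloop : ∀ (e : Fin m) (x : Fin (m + 1)), ¬ (treeEdgeList m π h.le).toGraph.IsLoopAt e x := by
    intro e x hx
    have h₁ : π e = x ∧ e + 1 = (x : ℕ) := by
      rcases (hlink e x x).1 hx with h | h <;> exact h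
    have := h.eq_zero_of_periodic (w := e + 1) (t := 1) e.2 one_pos (by
      rw [Function.iterate_one, parent_succ, h₁.1, h₁.2])
    omega
  have hconn : (treeEdgeList m π h.le).toGraph.toSimpleGraph.Connected := by
    let r : (treeEdgeList m π h.le).toGraph.vertexSet := ⟨(0 : Fin (m + 1)), trivial⟩
    have key : ∀ t (w : (treeEdgeList m π h.le).toGraph.vertexSet),
        (parent π)^[t] (w.1 : Fin (m + 1)).1 = 0 →
        (treeEdgeList m π h.le).toGraph.toSimpleGraph.Reachable w r := by
      intro t
      induction t with
      | zero =>
        intro w hw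
        have : w = r := Subtype.ext (Fin.ext hw)
        rw [this]
      | succ t ih =>
        rintro ⟨⟨w, hw⟩, hmem⟩ hwt
        cases w with
        | zero => exact .refl _
        | succ e =>
          have he : e < m := Nat.lt_of_succ_lt_succ hw
          have hle := h.le e he
          have h₁ := ih ⟨(⟨π e, Nat.lt_succ_of_le hle⟩ : Fin (m + 1)), trivial⟩ hwt
          refine SimpleGraph.Reachable.trans (SimpleGraph.Adj.reachable ?_) h₁
          have hl := (hlink ⟨e, he⟩ ⟨e + 1, hw⟩ ⟨π e, Nat.lt_succ_of_le hle⟩).2 (.inr ⟨rfl, rfl⟩)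
          refine ⟨fun heq => ?_, ⟨e, he⟩, hl⟩
          have heq' : (⟨e + 1, hw⟩ : Fin (m + 1)) = ⟨π e, Nat.lt_succ_of_le hle⟩ :=
            congrArg Subtype.val heq
          exact hloop ⟨e, he⟩ ⟨e + 1, hw⟩ (heq' ▸ hl)
    have : Nonempty (treeEdgeList m π h.le).toGraph.vertexSet := ⟨r⟩
    refine ⟨fun a b => ?_⟩
    obtain ⟨t, ht⟩ := h.reach _ (Nat.le_of_lt_succ (a.1 : Fin (m + 1)).2)
    obtain ⟨t', ht'⟩ := h.reach _ (Nat.le_of_lt_succ (b.1 : Fin (m + 1)).2)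
    exact (key t a ht).trans (key t' b ht').symm
  refine ⟨⟨{ not_isLoopAt := hloop, eq_of_isLink := ?_ }, ?_⟩, ?_⟩
  · intro e f x y he hf
    have he := (hlink e x y).1 he
    have hf := (hlink f x y).1 hf
    by_contra hne
    have hne' : (e : ℕ) ≠ f := fun h => hne (Fin.ext h)
    -- Different edges have different children, so parallel edges would each have the other's child
    -- as parent: a cycle of length two.
    have h₁ : π e = f + 1 ∧ π f = e + 1 := by omega
    have := h.eq_zero_of_periodic (w := e + 1) (t := 2) e.2 two_pos (by
      rw [Function.iterate_succ_apply, Function.iterate_one, parent_succ, h₁.1, parent_succ, h₁.2])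
    omega
  · have : Finite (treeEdgeList m π h.le).toGraph.vertexSet :=
      inferInstanceAs (Finite (Set.univ : Set (Fin (m + 1))))
    have hV : Nat.card (treeEdgeList m π h.le).toGraph.vertexSet = m + 1 := by
      have : Nat.card (Set.univ : Set (Fin (m + 1))) = m + 1 := by simp
      exact this
    refine SimpleGraph.isTree_iff_connected_and_card.2 ⟨hconn, le_antisymm ?_ ?_⟩
    · rw [hV]
      refine Nat.add_le_add_right ?_ 1
      let f : Fin m → Sym2 (treeEdgeList m π h.le).toGraph.vertexSet := fun e =>
        s(⟨(⟨π e, Nat.lt_succ_of_le (h.le e e.2)⟩ : Fin (m + 1)), trivial⟩,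
          ⟨(e.succ : Fin (m + 1)), trivial⟩)
      have hsub : (treeEdgeList m π h.le).toGraph.toSimpleGraph.edgeSet ⊆ Set.range f := by
        intro z
        induction z with
        | h a b =>
          rintro ⟨-, e, he⟩
          refine ⟨e, Sym2.eq_iff.2 ?_⟩
          rcases (hlink e a.1 b.1).1 he with ⟨h₁, h₂⟩ | ⟨h₁, h₂⟩
          · exact .inl ⟨Subtype.ext (Fin.ext h₁), Subtype.ext (Fin.ext h₂)⟩
          · exact .inr ⟨Subtype.ext (Fin.ext h₁), Subtype.ext (Fin.ext h₂)⟩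
      calc _ = (treeEdgeList m π h.le).toGraph.toSimpleGraph.edgeSet.ncard := rfl
        _ ≤ (Set.range f).ncard := Set.ncard_le_ncard hsub (Set.finite_range f)
        _ ≤ Nat.card (Fin m) := Finite.card_range_le f
        _ = m := by simp
    · exact hconn.card_vert_le_card_edgeSet_add_one
  · intro v _
    have hl : {e | (treeEdgeList m π h.le).toGraph.IsLoopAt e v} = ∅ :=
      Set.eq_empty_of_forall_notMem fun e => hloop e v
    have hi : {e | (treeEdgeList m π h.le).toGraph.Inc e v} =
        {e : Fin m | π e = (v : Fin (m + 1)).1 ∨ e + 1 = (v : Fin (m + 1)).1} := by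
      ext e
      constructor
      · rintro ⟨y, hy⟩
        rcases (hlink e v y).1 hy with h | h
        · exact .inl h.1
        · exact .inr h.2
      · rintro (h₁ | h₁)
        · exact ⟨e.succ, (hlink e v _).2 (.inl ⟨h₁, rfl⟩)⟩
        · exact ⟨⟨π e, Nat.lt_succ_of_le (h.le e e.2)⟩, (hlink e v _).2 (.inr ⟨rfl, h₁⟩)⟩
    rw [degree, hl, hi, Set.ncard_empty, add_zero]
    refine (ncard_setOf_fin fun e =>
      π e = (v : Fin (m + 1)).1 ∨ e + 1 = (v : Fin (m + 1)).1).trans_le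
      ?_
    rw [filter_or]
    exact (card_union_le _ _).trans (hdeg _ (Nat.le_of_lt_succ (v : Fin (m + 1)).2))

/-- Edge `e` of the tree lies over edge `e` of `G`, so the two sets of edges to be counted are
equal. -/
theorem isHomImageBy_treeEdgeList {G : EdgeList} {π φ : ℕ → ℕ} (h : ∀ e < G.m, π e ≤ G.m)
    (hφ : ∀ w ≤ G.m, φ w < G.n) (honto : ∀ u < G.n, ∃ w ≤ G.m, φ w = u)
    (hedge : ∀ e < G.m, s(φ (π e), φ (e + 1)) = s(G.arcs.src e, G.arcs.dst e)) :
    IsHomImageBy G.toGraph (treeEdgeList G.m π h).toGraph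
      (fun w : Fin (G.m + 1) => (⟨φ w, hφ w (Nat.le_of_lt_succ w.2)⟩ : Fin G.n)) where
  image_eq := by
    refine Set.eq_univ_of_forall fun u => ?_
    obtain ⟨w, hw, hwu⟩ := honto u u.2
    exact ⟨(⟨w, Nat.lt_succ_of_le hw⟩ : Fin (G.m + 1)), trivial, Fin.ext hwu⟩
  ncard_eq u _ v _ := by
    congr 1
    ext e
    have he := hedge e (e : Fin G.m).2
    have hs : s((⟨φ (π (e : Fin G.m)), hφ _ (h _ (e : Fin G.m).2)⟩ : Fin G.n),
        (⟨φ ((e : Fin G.m) + 1), hφ _ (e : Fin G.m).2⟩ : Fin G.n)) =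
        s((G.ends e).1, (G.ends e).2) := by
      apply Sym2.map.injective Fin.val_injective
      simpa [EdgeList.arcs] using he
    constructor
    · intro hl
      exact ⟨_, _, rfl, hs.trans hl⟩
    · rintro ⟨x, y, hl, hxy⟩
      refine hs.symm.trans (Eq.trans ?_ hxy)
      exact congrArg (Sym2.map fun w : Fin (G.m + 1) =>
        (⟨φ w, hφ w (Nat.le_of_lt_succ w.2)⟩ : Fin G.n)) hl

end KTrail

namespace KTrail

open Finset Ram

/-! ### Subroutines: degrees, reachability, reversal of a path -/

/-- The edges stored in the arrays `0` and `1`. -/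
def arcsOf (s : State) : Arcs := ⟨s.arr 0, s.arr 1⟩

theorem card_filter_range_succ (p : ℕ → Prop) [DecidablePred p] (j : ℕ) :
    #{e ∈ range (j + 1) | p e} = #{e ∈ range j | p e} + if p j then 1 else 0 := by
  simp only [card_filter, sum_range_succ]

theorem Arcs.indeg_succ (D : Arcs) (j v : ℕ) :
    D.indeg (j + 1) v = D.indeg j v + if D.dst j = v then 1 else 0 :=
  card_filter_range_succ _ _

theorem Arcs.copies_succ (D : Arcs) (j v : ℕ) :
    D.copies (j + 1) v = D.copies j v + if D.dst j = v then 1 else 0 := by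
  simp only [copies, indeg_succ]; omega

theorem Arcs.deg_succ (D : Arcs) (j v : ℕ) : D.deg (j + 1) v =
    D.deg j v + (if D.src j = v then 1 else 0) + if D.dst j = v then 1 else 0 := by
  simp only [deg, indeg_succ, card_filter_range_succ]; omega

/-- Register `12` becomes `k` times the number of copies of the vertex in register `10`, and
register `13` its degree. -/
def count : Prog :=
  .seq (.assign 12 (.const 0)) <| .seq (.assign 13 (.const 0)) <|
  .seq (.cond (.reg 10) .skip (.assign 12 (.reg 0))) <|
  .forTo 11 2 <|
    .seq (.cond (.ne (.get 0 (.reg 11)) (.reg 10)) .skip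
      (.assign 13 (.add (.reg 13) (.const 1))))
    (.cond (.ne (.get 1 (.reg 11)) (.reg 10)) .skip
      (.seq (.assign 13 (.add (.reg 13) (.const 1))) (.assign 12 (.add (.reg 12) (.reg 0)))))

/-- For want of multiplication, `k` is added to register `12` once for every entering edge, and once
at the start for the vertex 0. -/
theorem run_count {L m : ℕ} {s : State} (hm : s.reg 2 = m) (hL : m ≤ L) :
    Run L count s fun s' => s'.reg 12 = s.reg 0 * (arcsOf s).copies m (s.reg 10) ∧
      s'.reg 13 = (arcsOf s).deg m (s.reg 10) := by
  refine Run.assign_seq (Run.assign_seq (Run.seq (Q' := fun s' =>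
    s'.reg 12 = (if s.reg 10 = 0 then s.reg 0 else 0) ∧ s'.reg 13 = 0 ∧ s'.reg 10 = s.reg 10 ∧
      s'.reg 0 = s.reg 0 ∧ s'.reg 2 = s.reg 2 ∧ s'.arr = s.arr) (Run.cond ?_ ?_) ?_))
  · intro h
    refine Run.skip ?_
    simp only [Expr.eval, State.setReg_reg] at h ⊢
    simp at h
    simp [h, State.setReg]
  · intro h
    refine Run.assign ?_
    simp only [Expr.eval, State.setReg_reg] at h ⊢
    simp at h
    simp [h, State.setReg]
  rintro s₁ ⟨h12, h13, h10, h0, h2, harr⟩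
  refine Run.forTo (fun j s' => s'.reg 12 = s.reg 0 * (arcsOf s).copies j (s.reg 10) ∧
    s'.reg 13 = (arcsOf s).deg j (s.reg 10)) (h2.trans hm) rfl hL ?_ ?_ fun _ h => h
  · constructor
    · simp only [State.setReg_reg, h12, Arcs.copies, Arcs.indeg]
      split_ifs <;> simp_all
    · simp [h13, Arcs.deg, Arcs.indeg]
  · rintro j hj s₂ ⟨i12, i13⟩ h11 hr ha
    have i10 : s₂.reg 10 = s.reg 10 := (hr 10 rfl).trans h10
    have i0 : s₂.reg 0 = s.reg 0 := (hr 0 rfl).trans h0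
    have ia0 : s₂.arr 0 = (arcsOf s).src := by rw [ha 0 rfl, harr]; rfl
    have ia1 : s₂.arr 1 = (arcsOf s).dst := by rw [ha 1 rfl, harr]; rfl
    rw [Arcs.copies_succ, Arcs.deg_succ]
    refine Run.seq (Q' := fun s' => s'.reg 13 = (arcsOf s).deg j (s.reg 10) +
      (if (arcsOf s).src j = s.reg 10 then 1 else 0) ∧ (∀ r ≠ 13, s'.reg r = s₂.reg r) ∧
      s'.arr = s₂.arr) (Run.cond ?_ ?_) ?_
    · intro h
      rw [Ne, Expr.eval_ne] at h
      simp only [Expr.eval, ia0, h11, i10] at h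
      exact Run.skip ⟨by simp [i13, h], fun _ _ => rfl, rfl⟩
    · intro h
      rw [Expr.eval_ne] at h
      simp only [Expr.eval, ia0, h11, i10] at h
      refine Run.assign ⟨by simp [Expr.eval, i13, h], fun r hr => by simp [hr], rfl⟩
    · rintro s₃ ⟨j13, jr, ja⟩
      refine Run.cond ?_ ?_
      · intro h
        rw [Ne, Expr.eval_ne] at h
        simp only [Expr.eval, ja, ia1, jr 11, jr 10, h11, i10, ne_eq,
          not_false_eq_true, Nat.reduceEqDiff] at h
        exact Run.skip (by simp [h, j13, jr 12, i12])
      · intro h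
        rw [Expr.eval_ne] at h
        simp only [Expr.eval, ja, ia1, jr 11, jr 10, h11, i10, ne_eq,
          not_false_eq_true, Nat.reduceEqDiff] at h
        exact Run.assign_seq (Run.assign
          (by simp [Expr.eval, h, j13, jr 12, jr 0, i12, i0, mul_add]))

/-- The marks that a search from the vertex `start` has made so far: marked vertices have non-zero
entries in `mk`, and `pr` gives for each of them, except `start`, an edge from an earlier one. -/
structure Marks (D : Arcs) (n m start : ℕ) (mk pr : ℕ → ℕ) : Prop where
  start_ne : mk start ≠ 0
  pred : ∀ x < n, mk x ≠ 0 → x = start ∨ (pr x < m ∧ D.dst (pr x) = x ∧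
    mk (D.src (pr x)) ≠ 0 ∧ mk (D.src (pr x)) < mk x)
  le : ∀ x < n, mk x ≤ n

variable {D : Arcs} {n m start L : ℕ} {mk pr : ℕ → ℕ} {s : State}

/-- Predecessors have smaller marks, so going back ends at `start`. -/
theorem Marks.reach (h : Marks D n m start mk pr) (hval : ∀ e < m, D.src e < n ∧ D.dst e < n)
    {x : ℕ} (hx : x < n) (hmk : mk x ≠ 0) : D.Reach m start x := by
  induction hr : mk x using Nat.strong_induction_on generalizing x with
  | _ r ih =>
    rcases h.pred x hx hmk with rfl | ⟨h₁, h₂, h₃, h₄⟩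
    · exact .refl
    · exact (ih _ (hr ▸ h₄) (hval _ h₁).1 h₃ rfl).tail ⟨_, h₁, rfl, h₂⟩

theorem Marks.mk_ne_zero (h : Marks D n m start mk pr)
    (hcl : ∀ e < m, mk (D.src e) ≠ 0 → mk (D.dst e) ≠ 0) {x : ℕ} (hx : D.Reach m start x) :
    mk x ≠ 0 := by
  induction hx with
  | refl => exact h.start_ne
  | tail _ h' ih =>
    obtain ⟨e, he, rfl, rfl⟩ := h'
    exact hcl e he ih

/-- The new mark exceeds all earlier ones, and the head was unmarked, so no existing predecessor
link is disturbed. -/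
theorem Marks.extend (h : Marks D n m start mk pr) (hval : ∀ e < m, D.src e < n ∧ D.dst e < n)
    {e c : ℕ} (he : e < m) (hs : mk (D.src e) ≠ 0) (hd : mk (D.dst e) = 0)
    (hle : ∀ x < n, mk x ≤ c) (hc : c + 1 ≤ n) :
    Marks D n m start (Function.update mk (D.dst e) (c + 1)) (Function.update pr (D.dst e) e) where
  start_ne := by
    have : start ≠ D.dst e := fun h' => h.start_ne (h' ▸ hd)
    rw [Function.update_of_ne this]
    exact h.start_ne
  pred x hx hmk := by
    have hne : ∀ y, mk y ≠ 0 → y ≠ D.dst e := fun y hy h' => hy (h' ▸ hd)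
    by_cases hxd : x = D.dst e
    · subst hxd
      rw [Function.update_self, Function.update_self, Function.update_of_ne (hne _ hs)]
      exact .inr ⟨he, rfl, hs, Nat.lt_succ_of_le (hle _ (hval e he).1)⟩
    · rw [Function.update_of_ne hxd] at hmk
      rcases h.pred x hx hmk with h₁ | ⟨h₁, h₂, h₃, h₄⟩
      · exact .inl h₁
      · rw [Function.update_of_ne hxd, Function.update_of_ne hxd, Function.update_of_ne (hne _ h₃)]
        exact .inr ⟨h₁, h₂, h₃, h₄⟩
  le x hx := by
    rw [Function.update_apply]
    split_ifs
    · exact hc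
    · exact h.le x hx

theorem card_filter_update_eq_zero {d c : ℕ} (hd : d < n) (h : mk d = 0) :
    #{x ∈ range n | Function.update mk d (c + 1) x = 0} + 1 = #{x ∈ range n | mk x = 0} := by
  rw [← card_erase_add_one (a := d) (s := {x ∈ range n | mk x = 0}) (by simp [hd, h])]
  congr 2
  ext x
  by_cases hx : x = d <;> simp [hx]

/-- Mark the vertices that are reachable from the vertex in register `20`. -/
def reach : Prog :=
  .seq (.forTo 21 1 (.store 3 (.reg 21) (.const 0))) <|
  .seq (.store 3 (.reg 20) (.const 1)) <| .seq (.assign 23 (.const 1)) <|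
  .search 22 <| .forTo 21 2 <|
    .cond (.get 3 (.get 0 (.reg 21)))
      (.cond (.get 3 (.get 1 (.reg 21))) .skip <|
        .seq (.assign 23 (.add (.reg 23) (.const 1))) <|
        .seq (.store 3 (.get 1 (.reg 21)) (.reg 23)) <|
        .seq (.store 4 (.get 1 (.reg 21)) (.reg 21)) <|
        .assign 22 (.const 1))
      .skip

theorem run_reach (hn : s.reg 1 = n) (hm : s.reg 2 = m) (hst : s.reg 20 = start) (hlt : start < n)
    (hval : ∀ e < m, (arcsOf s).src e < n ∧ (arcsOf s).dst e < n) (hnL : n ≤ L) (hmL : m ≤ L) :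
    Run L reach s fun s' => Marks (arcsOf s) n m start (s'.arr 3) (s'.arr 4) ∧
      ∀ e < m, s'.arr 3 ((arcsOf s).src e) ≠ 0 → s'.arr 3 ((arcsOf s).dst e) ≠ 0 := by
  refine Run.seq (Run.forTo (fun j s' => ∀ x < j, s'.arr 3 x = 0) hn rfl hnL (by simp) ?_
    fun _ h => h).frame ?_
  · intro j _ s' h hj _ _
    refine Run.store fun x hx => ?_
    rcases Nat.lt_succ_iff_lt_or_eq.1 hx with h' | rfl
    · simp [Expr.eval, hj, Function.update_of_ne h'.ne, h x h']
    · simp [Expr.eval, hj]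
  rintro s₁ ⟨h₁, hf⟩
  have g1 : s₁.reg 1 = n := (hf.reg 1 rfl).trans hn
  have g2 : s₁.reg 2 = m := (hf.reg 2 rfl).trans hm
  have g20 : s₁.reg 20 = start := (hf.reg 20 rfl).trans hst
  have ga0 : s₁.arr 0 = (arcsOf s).src := hf.arr 0 rfl
  have ga1 : s₁.arr 1 = (arcsOf s).dst := hf.arr 1 rfl
  refine Run.store_seq (Run.assign_seq ?_)
  -- Register `23` holds the largest mark given so far. Its sum with the number of unmarked vertices
  -- stays at most `n`; this bounds the marks, and later the iterations of `reverse`.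
  let Rep : (ℕ → ℕ) → State → Prop := fun mk s' => s'.arr 3 = mk ∧
    Marks (arcsOf s) n m start mk (s'.arr 4) ∧ (∀ x < n, mk x ≤ s'.reg 23) ∧
    s'.reg 23 + #{x ∈ range n | mk x = 0} ≤ n ∧ s'.reg 2 = m ∧
    s'.arr 0 = (arcsOf s).src ∧ s'.arr 1 = (arcsOf s).dst
  refine Run.search (Rep := Rep) (μ := fun mk => #{x ∈ range n | mk x = 0})
    (F := fun mk => ∀ e < m, mk ((arcsOf s).src e) ≠ 0 → mk ((arcsOf s).dst e) ≠ 0)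
    (a := Function.update (s₁.arr 3) start 1) ?_ ?_ ?_ ?_ ?_
  · rintro mk s' c ⟨r₁, r₂, r₃, r₄, r₅, r₆, r₇⟩
    exact ⟨r₁, r₂, r₃, r₄, r₅, r₆, r₇⟩
  · intro mk s' hrep
    refine Run.scan (Rep := Rep) (F := fun mk e =>
      mk ((arcsOf s).src e) ≠ 0 → mk ((arcsOf s).dst e) ≠ 0) ?_ rfl hmL ?_ hrep hrep.2.2.2.2.1
    · rintro mk s' c ⟨r₁, r₂, r₃, r₄, r₅, r₆, r₇⟩
      exact ⟨r₁, r₂, r₃, r₄, r₅, r₆, r₇⟩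
    rintro e he mk s' ⟨r₁, r₂, r₃, r₄, r₅, r₆, r₇⟩ r21
    have hrep : Rep mk s' := ⟨r₁, r₂, r₃, r₄, r₅, r₆, r₇⟩
    refine Run.cond (fun c₁ => Run.cond (fun c₂ => Run.skip ?_) fun c₂ => ?_)
      fun c₁ => Run.skip ?_
    · simp only [Expr.eval, r₁, r₇, r21] at c₂
      exact .inr ⟨hrep, rfl, fun _ => c₂⟩
    · simp only [Expr.eval, r₁, r₆, r₇, r21] at c₁ c₂
      have hcard := card_filter_update_eq_zero (c := s'.reg 23) (hval e he).2 c₂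
      refine Run.assign_seq (Run.store_seq (Run.store_seq (Run.assign (.inl
        ⟨Function.update mk ((arcsOf s).dst e) (s'.reg 23 + 1), ⟨?_, ?_, ?_, ?_, ?_, ?_, ?_⟩,
          ?_, ?_⟩))))
      · simp [Expr.eval, r₁, r₇, r21]
      · have := r₂.extend hval he c₁ c₂ r₃ (by omega)
        simpa [Expr.eval, r₇, r21] using this
      · intro x hx
        have := r₃ x hx
        simp only [Function.update_apply, Expr.eval, State.setReg_reg, State.setArr_reg]
        split_ifs <;> simp at this ⊢ <;> omega
      · simp [Expr.eval]
        omega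
      · simp [r₅]
      · simp [r₆]
      · simp [r₇]
      · beta_reduce
        omega
      · simp [Expr.eval]
    · simp only [Expr.eval, r₁, r₆, r21] at c₁
      exact .inr ⟨hrep, rfl, fun h => absurd c₁ h⟩
  · have hz : ∀ x < n, x ≠ start → Function.update (s₁.arr 3) start 1 x = 0 := fun x hx hne => by
      rw [Function.update_of_ne hne, h₁ x hx]
    have hone : ∀ x < n, Function.update (s₁.arr 3) start 1 x ≤ 1 := fun x hx => by
      by_cases hne : x = start
      · simp [hne]
      · simp [hz x hx hne]
    refine ⟨by simp [Expr.eval, g20], ⟨by simp, fun x hx hmk => .inl ?_, fun x hx => ?_⟩, ?_, ?_,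
      by simp [g2], by simp [ga0], by simp [ga1]⟩
    · by_contra hne
      exact hmk (hz x hx hne)
    · exact (hone x hx).trans (by omega)
    · simpa [Expr.eval] using hone
    · have := card_filter_update_eq_zero (mk := fun _ => 0) (c := 0) hlt rfl
      have heq : #{x ∈ range n | Function.update (s₁.arr 3) start 1 x = 0} =
          #{x ∈ range n | Function.update (fun _ => 0) start (0 + 1) x = 0} := by
        refine congrArg card (filter_congr fun x hx => ?_)
        by_cases hne : x = start
        · simp [hne]
        · simp [h₁ x (mem_range.1 hx), hne]
      rw [heq]
      simp only [State.setReg_reg, Expr.eval, if_true, filter_true, card_range] at this ⊢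
      omega
  · refine lt_of_lt_of_le (card_lt_card (t := range n) ?_) ((card_range n).trans_le hnL)
    exact (filter_ssubset).2 ⟨start, mem_range.2 hlt, by simp⟩
  · rintro mk s' ⟨rfl, r₂, -⟩ hF
    exact ⟨r₂, hF⟩

/-- Reverse the path from the vertex in register `20` to the vertex in register `24`. -/
def reverse : Prog :=
  .loop (.ne (.reg 24) (.reg 20)) <|
    .seq (.assign 25 (.get 4 (.reg 24))) <|
    .seq (.assign 26 (.get 0 (.reg 25))) <|
    .seq (.store 0 (.reg 25) (.reg 24)) <|
    .seq (.store 1 (.reg 25) (.reg 26)) <|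
    .assign 24 (.reg 26)

/-- Indegrees do not depend on tails, so these may be replaced by any `f`. -/
theorem Arcs.indeg_update (D : Arcs) {e : ℕ} (he : e < m) (f : ℕ → ℕ) (t y : ℕ) :
    (⟨f, Function.update D.dst e t⟩ : Arcs).indeg m y + (if D.dst e = y then 1 else 0) =
      D.indeg m y + if t = y then 1 else 0 := by
  simp only [indeg, card_filter]
  rw [← add_sum_erase _ _ (mem_range.2 he), ← add_sum_erase _ _ (mem_range.2 he),
    sum_congr rfl fun x hx => by rw [Function.update_of_ne (ne_of_mem_erase hx)],
    Function.update_self]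
  omega

/-- Each reversal moves one unit of indegree from the current vertex to its predecessor; along the
path this telescopes. Marks decrease on the way, so there are at most `n` steps. -/
theorem run_reverse {u : ℕ} (hu : s.reg 24 = u) (hun : u < n) (hst : s.reg 20 = start)
    (hval : ∀ e < m, (arcsOf s).src e < n ∧ (arcsOf s).dst e < n)
    (hmk : Marks (arcsOf s) n m start mk (s.arr 4)) (hmku : mk u ≠ 0) (hnL : n ≤ L) :
    Run L reverse s fun s' => (arcsOf s').Same m (arcsOf s) ∧
      (∀ e ≥ m, s'.arr 0 e = s.arr 0 e ∧ s'.arr 1 e = s.arr 1 e) ∧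
      ∀ y, (arcsOf s').indeg m y + (if u = y then 1 else 0) =
        (arcsOf s).indeg m y + if start = y then 1 else 0 := by
  refine Run.loop (fun s' => (arcsOf s').Same m (arcsOf s) ∧ s'.reg 24 < n ∧ mk (s'.reg 24) ≠ 0 ∧
    (∀ y, (arcsOf s').indeg m y + (if u = y then 1 else 0) =
      (arcsOf s).indeg m y + if s'.reg 24 = y then 1 else 0) ∧
    -- Tails are read from the arrays being modified. Predecessor edges of vertices marked no later
    -- than the current one must therefore be still intact.
    (∀ y < n, mk y ≠ 0 → mk y ≤ mk (s'.reg 24) → y ≠ start →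
      s'.arr 0 (s.arr 4 y) = s.arr 0 (s.arr 4 y) ∧ s'.arr 1 (s.arr 4 y) = y) ∧
    ∀ e ≥ m, s'.arr 0 e = s.arr 0 e ∧ s'.arr 1 e = s.arr 1 e)
    (fun s' => mk (s'.reg 24)) ?_ ?_ ?_ ?_
  · rintro s' ⟨h₁, h₂, h₃, h₄, h₅, h10⟩ hf hx
    have g20 : s'.reg 20 = start := (hf.reg 20 rfl).trans hst
    have ga4 : s'.arr 4 = s.arr 4 := hf.arr 4 rfl
    rw [Ne, Expr.eval_ne] at hx
    simp only [Expr.eval, g20] at hx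
    obtain ⟨h₆, h₇, h₈, h₉⟩ := (hmk.pred _ h₂ h₃).resolve_left hx
    obtain ⟨i₁, i₂⟩ := h₅ _ h₂ h₃ le_rfl hx
    refine Run.assign_seq (Run.assign_seq (Run.store_seq (Run.store_seq (Run.assign ?_))))
    simp only [Expr.eval, State.setReg_reg, State.setArr_reg, State.setReg_arr, State.setArr_arr,
      arcsOf, Nat.reduceEqDiff, if_true, if_false, one_ne_zero, zero_ne_one, ga4, i₁]
    generalize s'.reg 24 = x at *
    generalize hpe : s.arr 4 x = e at *
    have htail := (hval e h₆).1
    refine ⟨⟨fun e' he' => ?_, htail, h₈, fun y => ?_, fun y hy hy₀ hy₁ hys => ?_,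
      fun e' he' => ?_⟩, h₉⟩
    · by_cases hee : e' = e
      · subst hee
        simp only [Function.update_self]
        rw [Sym2.eq_swap]
        exact congrArg (fun z => s(s.arr 0 e', z)) h₇.symm
      · simp only [Function.update_of_ne hee]
        exact h₁ e' he'
    · have hupd := (arcsOf s').indeg_update h₆ (Function.update (s'.arr 0) e x) (s.arr 0 e) y
      have hy := h₄ y
      simp only [arcsOf, i₂] at hupd hy ⊢
      omega
    · have hlt : mk y < mk x := hy₁.trans_lt h₉
      have hne : s.arr 4 y ≠ e := fun heq => by
        obtain ⟨-, hd, -⟩ := (hmk.pred y hy hy₀).resolve_left hys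
        rw [heq, h₇] at hd
        rw [hd] at hlt
        exact lt_irrefl _ hlt
      rw [Function.update_of_ne hne, Function.update_of_ne hne]
      exact h₅ y hy hy₀ hlt.le hys
    · have hne : e' ≠ e := fun heq => absurd h₆ (heq ▸ he').not_gt
      rw [Function.update_of_ne hne, Function.update_of_ne hne]
      exact h10 e' he'
  · refine ⟨.refl, hu ▸ hun, hu ▸ hmku, fun y => by rw [hu], fun y hy hy₀ _ hys => ⟨rfl, ?_⟩,
      fun _ _ => ⟨rfl, rfl⟩⟩
    exact ((hmk.pred y hy hy₀).resolve_left hys).2.1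
  · exact (hmk.le _ (hu ▸ hun)).trans hnL
  · rintro s' ⟨h₁, -, -, h₄, -, h₅⟩ hf hx
    have g20 : s'.reg 20 = start := (hf.reg 20 rfl).trans hst
    rw [Expr.eval_ne] at hx
    simp only [Expr.eval, g20] at hx
    exact ⟨h₁, h₅, fun y => by rw [h₄ y, hx]⟩

end KTrail

namespace KTrail

open Finset Ram

/-! ### Finding the orientation -/

namespace Arcs

variable {D D' : Arcs} {n m k u v : ℕ} {mk : ℕ → ℕ}

/-- The orientation with edge `e` reversed. -/
def swap (D : Arcs) (e : ℕ) : Arcs :=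
  ⟨Function.update D.src e (D.dst e), Function.update D.dst e (D.src e)⟩

theorem swap_same (D : Arcs) (e : ℕ) : (D.swap e).Same m D := by
  intro e' _
  by_cases h : e' = e
  · subst h; simp [swap, Sym2.eq_swap]
  · simp [swap, h]

/-- A path from `a` visits only vertices reachable from `a`, so it does not use `e`. -/
theorem Reach.swap {a b e : ℕ} (h : D.Reach m a b) (he : ¬ D.Reach m a (D.src e)) :
    (D.swap e).Reach m a b := by
  induction h with
  | refl => exact .refl
  | @tail b c hb h' ih =>
    obtain ⟨e', he', rfl, rfl⟩ := h'
    have hne : e' ≠ e := fun h => he (h ▸ hb)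
    exact ih.tail ⟨e', he', by simp [Arcs.swap, hne], by simp [Arcs.swap, hne]⟩

open Classical in
/-- The number of vertices that are not reachable from `0`. -/
noncomputable def unreached (D : Arcs) (n m : ℕ) : ℕ := #{x ∈ range n | ¬ D.Reach m 0 x}

theorem unreached_swap_lt {e : ℕ} (hval : ∀ e < m, D.src e < n ∧ D.dst e < n) (he : e < m)
    (h₁ : D.Reach m 0 (D.dst e)) (h₂ : ¬ D.Reach m 0 (D.src e)) :
    (D.swap e).unreached n m < D.unreached n m := by
  classical
  refine card_lt_card ((ssubset_iff_of_subset ?_).2 ⟨D.src e, ?_, ?_⟩)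
  · intro x hx
    simp only [mem_filter] at hx ⊢
    exact ⟨hx.1, fun h => hx.2 (h.swap h₂)⟩
  · simp [h₂, (hval e he).1]
  · simp only [mem_filter, not_and, not_not]
    exact fun _ => (h₁.swap h₂).tail ⟨e, he, by simp [swap], by simp [swap]⟩

theorem enter_unmarked (hval : ∀ e < m, D.src e < n ∧ D.dst e < n)
    (hcl : ∀ e < m, mk (D.src e) ≠ 0 → mk (D.dst e) ≠ 0) :
    D.enter m {x ∈ range n | mk x = 0} = 0 := by
  rw [enter, card_eq_zero, filter_eq_empty_iff]
  rintro e he ⟨h₁, h₂⟩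
  have he := mem_range.1 he
  simp only [mem_filter, mem_range, (hval e he).1, true_and] at h₁ h₂
  exact hcl e he h₁ h₂.2

/-- The unmet demand for copies. -/
def deficiency (D : Arcs) (n m k : ℕ) : ℕ := ∑ v ∈ range n, (D.deg m v - k * D.copies m v)

theorem deficiency_le (D : Arcs) (n m k : ℕ) : D.deficiency n m k ≤ n * (m + m) := by
  have : ∀ v ∈ range n, D.deg m v - k * D.copies m v ≤ m + m := fun v _ =>
    (Nat.sub_le _ _).trans (add_le_add ((card_filter_le _ _).trans_eq (card_range m))
      ((card_filter_le _ _).trans_eq (card_range m)))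
  simpa [deficiency] using sum_le_card_nsmul _ _ _ this

/-- No copy of `u` can be traded for a copy of `v`. -/
def Blocked (D : Arcs) (n m k v u : ℕ) : Prop :=
  k * D.copies m v < D.deg m v → D.deg m u + k ≤ k * D.copies m u →
    ∃ X ⊆ range n, D.Tight m X ∧ u ∈ X ∧ v ∉ X

/-- Orientations of the same graph for which `u` loses and `v` gains an entering edge. -/
structure Trade (D D' : Arcs) (m u v : ℕ) : Prop where
  same : D'.Same m D
  indeg : ∀ y, D'.indeg m y + (if u = y then 1 else 0) = D.indeg m y + if v = y then 1 else 0

/-- By `h₂` the demand of `u` is still met with one copy less, so only the term of `v` changes the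
sum, and it drops because `k` is positive. -/
theorem Trade.deficiency_lt (h : Trade D D' m u v) (hv : v < n) (hk : 0 < k)
    (h₁ : k * D.copies m v < D.deg m v) (h₂ : D.deg m u + k ≤ k * D.copies m u) :
    D'.deficiency n m k < D.deficiency n m k := by
  have huv : u ≠ v := by rintro rfl; omega
  have hc : ∀ y, D'.copies m y + (if u = y then 1 else 0) =
      D.copies m y + if v = y then 1 else 0 := fun y => by
    have := h.indeg y
    simp only [copies]
    omega
  refine sum_lt_sum (fun y _ => ?_) ⟨v, mem_range.2 hv, ?_⟩
  · rw [h.same.deg_eq]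
    by_cases huy : u = y
    · subst huy
      have := hc u
      simp only [if_true, if_neg huv.symm, add_zero] at this
      rw [← this, mul_add] at h₂
      omega
    · have := hc y
      simp only [if_neg huy] at this
      exact Nat.sub_le_sub_left (Nat.mul_le_mul_left k (by omega)) _
  · rw [h.same.deg_eq]
    have := hc v
    simp only [if_true, if_neg huv] at this
    rw [add_zero] at this
    rw [this, mul_add]
    omega

/-- No edge enters the set of unmarked vertices. By rootedness it must then contain 0, and so it is
tight. -/
theorem tight_of_unreached (hval : ∀ e < m, D.src e < n ∧ D.dst e < n) (hroot : D.Rooted m n)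
    (hcl : ∀ e < m, mk (D.src e) ≠ 0 → mk (D.dst e) ≠ 0) (hu : u < n) (hmku : mk u = 0)
    (hv : mk v ≠ 0) : ∃ X ⊆ range n, D.Tight m X ∧ u ∈ X ∧ v ∉ X := by
  have huX : u ∈ ({x ∈ range n | mk x = 0} : Finset ℕ) := by simp [hu, hmku]
  refine ⟨{x ∈ range n | mk x = 0}, filter_subset _ _, ?_, huX, by simp [hv]⟩
  have h₁ := enter_unmarked hval hcl
  have h₂ := hroot.le_enter (X := {x ∈ range n | mk x = 0}) (filter_subset _ _) ⟨u, huX⟩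
  rw [Tight, h₁]
  omega

/-- After the trade no edge enters the set of vertices that 0 no longer reaches, whereas before at
least one did. Comparing sums of indegrees, exactly one edge entered it, and the set contains `u`
but not `v`. -/
theorem Trade.tight_of_unreached (h : Trade D D' m u v)
    (hval : ∀ e < m, D.src e < n ∧ D.dst e < n) (hroot : D.Rooted m n)
    (hcl : ∀ e < m, mk (D'.src e) ≠ 0 → mk (D'.dst e) ≠ 0) (h0 : mk 0 ≠ 0) {x : ℕ} (hx : x < n)
    (hmkx : mk x = 0) : ∃ X ⊆ range n, D.Tight m X ∧ u ∈ X ∧ v ∉ X := by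
  set X : Finset ℕ := {x ∈ range n | mk x = 0} with hX
  have h0X : 0 ∉ X := by simp [hX, h0]
  have h₁ : D'.enter m X = 0 := enter_unmarked (h.same.lt hval) hcl
  have h₂ := hroot.le_enter (X := X) (filter_subset _ _) ⟨x, by simp [hX, hx, hmkx]⟩
  have h₃ := sum_congr (rfl : X = X) fun y _ => h.indeg y
  simp only [sum_add_distrib, sum_indeg, h.same.inner_eq, sum_ite_eq] at h₃
  rw [if_neg h0X] at h₂
  refine ⟨X, filter_subset _ _, ?_, ?_, ?_⟩
  · rw [Tight, if_neg h0X]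
    split_ifs at h₃ <;> omega
  · by_contra hu
    rw [if_neg hu] at h₃
    omega
  · intro hv
    rw [if_pos hv] at h₃
    split_ifs at h₃ <;> omega

end Arcs

/-! ### Programs that search for the orientation -/

/-- The memory contains the numbers `k`, `n`, `m` and the edges `D`. -/
structure Holds (k n m : ℕ) (D : Arcs) (s : State) : Prop where
  k : s.reg 0 = k
  n : s.reg 1 = n
  m : s.reg 2 = m
  arcs : arcsOf s = D

variable {k n m L : ℕ} {D D₀ : Arcs} {s s' : State} {P : Prog}

theorem Holds.setReg (h : Holds k n m D s) {r : ℕ} (c : ℕ) (hr : 3 ≤ r := by decide) :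
    Holds k n m D (s.setReg r c) where
  k := by rw [State.setReg_reg, if_neg (by omega), h.k]
  n := by rw [State.setReg_reg, if_neg (by omega), h.n]
  m := by rw [State.setReg_reg, if_neg (by omega), h.m]
  arcs := h.arcs

theorem Holds.of_frame_of_arcs (h : Holds k n m D s) (hf : Frame P s s') {D' : Arcs}
    (hD : arcsOf s' = D')
    (hP : (P.keepsReg 0 && P.keepsReg 1 && P.keepsReg 2) = true := by rfl) :
    Holds k n m D' s' := by
  simp only [Bool.and_eq_true] at hP
  exact ⟨(hf.reg 0 hP.1.1).trans h.k, (hf.reg 1 hP.1.2).trans h.n, (hf.reg 2 hP.2).trans h.m, hD⟩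

theorem Holds.of_frame (h : Holds k n m D s) (hf : Frame P s s')
    (hP : (P.keepsReg 0 && P.keepsReg 1 && P.keepsReg 2 && P.keepsArr 0 && P.keepsArr 1) = true
      := by rfl) : Holds k n m D s' := by
  simp only [Bool.and_eq_true] at hP
  refine h.of_frame_of_arcs hf ?_ (by simp [hP])
  rw [← h.arcs, arcsOf, arcsOf, hf.arr 0 hP.1.2, hf.arr 1 hP.2]

theorem Holds.src (h : Holds k n m D s) (e : ℕ) : s.arr 0 e = D.src e := by rw [← h.arcs]; rfl

theorem Holds.dst (h : Holds k n m D s) (e : ℕ) : s.arr 1 e = D.dst e := by rw [← h.arcs]; rfl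

theorem Holds.run_count (h : Holds k n m D s) (hL : m ≤ L) {x : Expr} :
    Run L (.seq (.assign 10 x) count) s fun s' => Holds k n m D s' ∧
      s'.reg 12 = k * D.copies m (x.eval s) ∧ s'.reg 13 = D.deg m (x.eval s) := by
  have h' := h.setReg (r := 10) (x.eval s)
  refine Run.assign_seq ((KTrail.run_count h'.m hL).frame.mono fun s' ⟨⟨h₁, h₂⟩, hf⟩ => ?_)
  rw [h'.arcs] at h₁ h₂
  rw [h'.k] at h₁
  exact ⟨h'.of_frame hf, by simpa using h₁, by simpa using h₂⟩

theorem Holds.run_reach (h : Holds k n m D s) {x : Expr} (hx : x.eval s < n)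
    (hval : ∀ e < m, D.src e < n ∧ D.dst e < n) (hnL : n ≤ L) (hmL : m ≤ L) :
    Run L (.seq (.assign 20 x) reach) s fun s' => Holds k n m D s' ∧
      Marks D n m (x.eval s) (s'.arr 3) (s'.arr 4) ∧ s'.reg 20 = x.eval s ∧
      ∀ e < m, s'.arr 3 (D.src e) ≠ 0 → s'.arr 3 (D.dst e) ≠ 0 := by
  have h' := h.setReg (r := 20) (x.eval s)
  refine Run.assign_seq ((KTrail.run_reach h'.n h'.m rfl (start := x.eval s) (by simpa using hx)
    (by rw [h'.arcs]; exact hval) hnL hmL).frame.mono fun s' ⟨⟨h₁, h₂⟩, hf⟩ => ?_)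
  rw [h'.arcs] at h₁ h₂
  have h20 := hf.reg 20 rfl
  rw [State.setReg_reg, if_pos rfl] at h20
  exact ⟨h'.of_frame hf, by simpa using h₁, h20, h₂⟩

/-- Reverse edges until all vertices are reachable from `0`. -/
def orient : Prog :=
  .search 5 <| .forTo 3 2 <| .seq (.seq (.assign 20 (.const 0)) reach) <|
    .cond (.get 3 (.get 1 (.reg 3)))
      (.cond (.get 3 (.get 0 (.reg 3))) .skip <|
        .seq (.assign 6 (.get 0 (.reg 3))) <|
        .seq (.store 0 (.reg 3) (.get 1 (.reg 3))) <|
        .seq (.store 1 (.reg 3) (.reg 6)) <|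
        .assign 5 (.const 1))
      .skip

/-- Reversing an edge from an unreached to a reached vertex loses no reached vertex and gains its
tail. At the end the reached set is closed under edges in both directions; connectedness of the
graph will make it everything. -/
theorem run_orient (h : Holds k n m D₀ s) (hval : ∀ e < m, D₀.src e < n ∧ D₀.dst e < n)
    (hn : 0 < n) (hnL : n < L) (hmL : m ≤ L) :
    Run L orient s fun s' => ∃ D, Holds k n m D s' ∧ D.Same m D₀ ∧
      ∀ e < m, D.Reach m 0 (D.dst e) → D.Reach m 0 (D.src e) := by
  classical
  let Rep : Arcs → State → Prop := fun D s => Holds k n m D s ∧ D.Same m D₀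
  refine Run.search (Rep := Rep) (μ := fun D => D.unreached n m) (a := D₀)
    (F := fun D => ∀ e < m, D.Reach m 0 (D.dst e) → D.Reach m 0 (D.src e))
    (fun D s c h => ⟨h.1.setReg _, h.2⟩) ?_ ⟨h, .refl⟩
    (((card_filter_le _ _).trans_eq (card_range n)).trans_lt hnL)
    (fun D s h hF => ⟨D, h.1, h.2, hF⟩)
  intro D s h
  refine Run.scan (Rep := Rep) (F := fun D e => D.Reach m 0 (D.dst e) → D.Reach m 0 (D.src e))
    (fun D s c h => ⟨h.1.setReg _, h.2⟩) rfl hmL ?_ h h.1.m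
  rintro e he D s ⟨h, hs⟩ h3
  have hval := hs.lt hval
  refine Run.seq (h.run_reach (x := .const 0) hn hval hnL.le hmL).frame
    fun s₁ ⟨⟨h₁, h₂, _, hcl⟩, hf⟩ => ?_
  simp only [Expr.eval] at h₂
  have g3 : s₁.reg 3 = e := (hf.reg 3 rfl).trans h3
  have hflag : s₁.reg 5 = s.reg 5 := hf.reg 5 rfl
  have hmk : ∀ x < n, s₁.arr 3 x ≠ 0 ↔ D.Reach m 0 x := fun x hx =>
    ⟨h₂.reach hval hx, h₂.mk_ne_zero hcl⟩
  refine Run.cond (fun c₁ => Run.cond (fun c₂ => Run.skip ?_) fun c₂ => ?_) fun c₁ => Run.skip ?_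
  · simp only [Expr.eval, g3, h₁.src] at c₂
    exact .inr ⟨⟨h₁, hs⟩, hflag, fun _ => (hmk _ (hval e he).1).1 c₂⟩
  · simp only [Expr.eval, g3, h₁.src, h₁.dst] at c₁ c₂
    refine Run.assign_seq (Run.store_seq (Run.store_seq (Run.assign (.inl ⟨D.swap e,
      ⟨?_, (D.swap_same e).trans hs⟩, Arcs.unreached_swap_lt hval he ((hmk _ (hval e he).2).1 c₁)
        fun h => (hmk _ (hval e he).1).2 h c₂, ?_⟩))))
    · refine ⟨by simp [h₁.k], by simp [h₁.n], by simp [h₁.m], ?_⟩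
      have ha0 : s₁.arr 0 = D.src := funext h₁.src
      have ha1 : s₁.arr 1 = D.dst := funext h₁.dst
      simp [arcsOf, Expr.eval, g3, ha0, ha1, Arcs.swap]
    · simp [Expr.eval]
  · simp only [Expr.eval, g3, h₁.dst] at c₁
    exact .inr ⟨⟨h₁, hs⟩, hflag, fun h => absurd c₁ ((hmk _ (hval e he).2).2 h)⟩

/-- Save the edges in the arrays `5` and `6`. -/
def backup : Prog :=
  .forTo 27 2 <| .seq (.store 5 (.reg 27) (.get 0 (.reg 27)))
    (.store 6 (.reg 27) (.get 1 (.reg 27)))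

/-- Fetch the edges from the arrays `5` and `6`. -/
def restore : Prog :=
  .forTo 27 2 <| .seq (.store 0 (.reg 27) (.get 5 (.reg 27)))
    (.store 1 (.reg 27) (.get 6 (.reg 27)))

theorem run_backup (hm : s.reg 2 = m) (hL : m ≤ L) : Run L backup s fun s' =>
    ∀ e < m, s'.arr 5 e = s.arr 0 e ∧ s'.arr 6 e = s.arr 1 e := by
  refine Run.forTo (fun j s' => ∀ e < j, s'.arr 5 e = s.arr 0 e ∧ s'.arr 6 e = s.arr 1 e) hm rfl hL
    (by simp) ?_ fun _ h => h
  intro j _ s' h hj _ ha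
  refine Run.store_seq (Run.store fun e he => ?_)
  rcases Nat.lt_succ_iff_lt_or_eq.1 he with h' | rfl
  · simp [Expr.eval, hj, Function.update_of_ne h'.ne, h e h']
  · simp [Expr.eval, hj, ha 0 rfl, ha 1 rfl]

/-- Entries from `m` on are tracked as well, because `Holds` asks for equality of whole arrays. -/
theorem run_restore (hm : s.reg 2 = m) (hL : m ≤ L) : Run L restore s fun s' =>
    (∀ e < m, s'.arr 0 e = s.arr 5 e ∧ s'.arr 1 e = s.arr 6 e) ∧
    ∀ e ≥ m, s'.arr 0 e = s.arr 0 e ∧ s'.arr 1 e = s.arr 1 e := by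
  refine Run.forTo (fun j s' => (∀ e < j, s'.arr 0 e = s.arr 5 e ∧ s'.arr 1 e = s.arr 6 e) ∧
    ∀ e ≥ j, s'.arr 0 e = s.arr 0 e ∧ s'.arr 1 e = s.arr 1 e) hm rfl hL
    (by simp) ?_ fun _ h => h
  rintro j _ s' ⟨h, h'⟩ hj _ ha
  refine Run.store_seq (Run.store ⟨fun e he => ?_, fun e he => ?_⟩)
  · rcases Nat.lt_succ_iff_lt_or_eq.1 he with h' | rfl
    · simp [Expr.eval, hj, Function.update_of_ne h'.ne, h e h']
    · simp [Expr.eval, hj, ha 5 rfl, ha 6 rfl]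
  · have hne : e ≠ j := by omega
    simp [Expr.eval, hj, Function.update_of_ne hne, h' e (by omega)]

/-- Register `28` becomes zero if all vertices are marked, and non-zero otherwise. -/
def someUnmarked : Prog :=
  .seq (.assign 28 (.const 0)) <| .forTo 29 1 <|
    .cond (.get 3 (.reg 29)) .skip (.assign 28 (.const 1))

theorem run_someUnmarked (hn : s.reg 1 = n) (hL : n ≤ L) : Run L someUnmarked s fun s' =>
    s'.reg 28 = 0 ↔ ∀ x < n, s.arr 3 x ≠ 0 := by
  refine Run.assign_seq (Run.forTo (fun j s' => s'.reg 28 = 0 ↔ ∀ x < j, s.arr 3 x ≠ 0)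
    (by simpa using hn) rfl hL (by simp [Expr.eval]) ?_ fun _ h => h)
  intro j _ s' h hj _ ha
  have ha3 : s'.arr 3 = s.arr 3 := ha 3 rfl
  refine Run.cond (fun c => Run.skip ?_) fun c => Run.assign ?_
  · simp only [Expr.eval, hj, ha3] at c
    simp only [State.setReg_reg, Nat.reduceEqDiff, if_false, h, Nat.lt_succ_iff_lt_or_eq]
    exact ⟨fun h x hx => hx.elim (h x) fun h => h ▸ c, fun h x hx => h x (.inl hx)⟩
  · simp only [Expr.eval, hj, ha3] at c
    simp only [State.setReg_reg, Nat.reduceEqDiff, if_false, if_true, Expr.eval, one_ne_zero,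
      false_iff]
    exact fun h => h j (Nat.lt_succ_self j) c

/-- Trade a copy of the vertex in register `4` for a copy of the vertex in register `3` if this is
possible and helps. -/
def trade : Prog :=
  .seq (.seq (.assign 10 (.reg 3)) count) <| .cond (.sub (.reg 13) (.reg 12))
    (.seq (.seq (.assign 10 (.reg 4)) count) <|
      .cond (.sub (.add (.reg 13) (.reg 0)) (.reg 12)) .skip <|
      .seq (.seq (.assign 20 (.reg 3)) reach) <| .cond (.get 3 (.reg 4))
        (.seq backup <| .seq (.assign 24 (.reg 4)) <| .seq reverse <|
          .seq (.seq (.assign 20 (.const 0)) reach) <| .seq someUnmarked <|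
          .cond (.reg 28) restore (.assign 5 (.const 1)))
        .skip)
    .skip

/-- Trade copies as long as this is possible and helps. -/
def tradeAll : Prog := .search 5 <| .forTo 3 1 <| .forTo 4 1 trade

/-- A reversal is tried out and undone if it destroys reachability. The two nontrivial ways to fail,
no path from `v` to `u` and loss of reachability, each supply the tight set that `Arcs.Blocked` asks
for. -/
theorem run_tradeAll (h : Holds k n m D s) (hval : ∀ e < m, D₀.src e < n ∧ D₀.dst e < n)
    (hk : 0 < k) (hn : 0 < n) (hs : D.Same m D₀) (hroot : D.Rooted m n) (hnL : n ≤ L) (hmL : m ≤ L)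
    (hL : n * (m + m) < L) :
    Run L tradeAll s fun s' => ∃ D, Holds k n m D s' ∧ D.Same m D₀ ∧ D.Rooted m n ∧
      ∀ v < n, ∀ u < n, D.Blocked n m k v u := by
  let Rep : Arcs → State → Prop := fun D s => Holds k n m D s ∧ D.Same m D₀ ∧ D.Rooted m n
  refine Run.search₂ (Rep := Rep) (μ := fun D => D.deficiency n m k) (a := D) (n := n) (m := n)
    (F := fun D v u => D.Blocked n m k v u)
    ?_ (fun D s h => h.1.n) (fun D s h => h.1.n) rfl hnL hnL ?_ ⟨h, hs, hroot⟩
    ((D.deficiency_le n m k).trans_lt hL) (fun D s h hF => ⟨D, h.1, h.2.1, h.2.2, hF⟩)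
  · rintro D s r x hr ⟨h₁, h₂⟩
    exact ⟨h₁.setReg _ (by omega), h₂⟩
  rintro v hv u hu D s ⟨h, hs, hroot⟩ hsv hsu
  have hval := hs.lt hval
  refine Run.seq (h.run_count hmL).frame fun s₁ ⟨⟨h₁, h12, h13⟩, hf⟩ => ?_
  simp only [Expr.eval, hsv] at h12 h13
  have g3 : s₁.reg 3 = v := (hf.reg 3 rfl).trans hsv
  have g4 : s₁.reg 4 = u := (hf.reg 4 rfl).trans hsu
  have g5 : s₁.reg 5 = s.reg 5 := hf.reg 5 rfl
  refine Run.cond (fun c₁ => ?_) fun c₁ => Run.skip (.inr ⟨⟨h₁, hs, hroot⟩, g5, fun hd => ?_⟩)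
  swap
  · simp only [Expr.eval, h12, h13] at c₁
    omega
  simp only [Expr.eval, h12, h13] at c₁
  refine Run.seq (h₁.run_count hmL).frame fun s₂ ⟨⟨h₂, i12, i13⟩, hf⟩ => ?_
  simp only [Expr.eval, g4] at i12 i13
  replace g3 : s₂.reg 3 = v := (hf.reg 3 rfl).trans g3
  replace g4 : s₂.reg 4 = u := (hf.reg 4 rfl).trans g4
  replace g5 : s₂.reg 5 = s.reg 5 := (hf.reg 5 rfl).trans g5
  refine Run.cond (fun c₂ => Run.skip (.inr ⟨⟨h₂, hs, hroot⟩, g5, fun _ hd => ?_⟩)) fun c₂ => ?_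
  · simp only [Expr.eval, i12, i13, h₂.k] at c₂
    omega
  simp only [Expr.eval, i12, i13, h₂.k] at c₂
  refine Run.seq (h₂.run_reach (x := .reg 3) (by simpa [Expr.eval, g3] using hv) hval hnL
    hmL).frame fun s₃ ⟨⟨h₃, hmk, h20, hcl⟩, hf⟩ => ?_
  simp only [Expr.eval, g3] at hmk h20
  replace g4 : s₃.reg 4 = u := (hf.reg 4 rfl).trans g4
  replace g5 : s₃.reg 5 = s.reg 5 := (hf.reg 5 rfl).trans g5
  refine Run.cond (fun c₃ => ?_) fun c₃ => Run.skip (.inr ⟨⟨h₃, hs, hroot⟩, g5, fun _ _ => ?_⟩)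
  swap
  · simp only [Expr.eval, g4] at c₃
    exact Arcs.tight_of_unreached hval hroot hcl hu c₃ hmk.start_ne
  simp only [Expr.eval, g4] at c₃
  refine Run.seq (run_backup h₃.m hmL).frame fun s₄ ⟨hb, hf⟩ => Run.assign_seq ?_
  have h₄ := (h₃.of_frame hf).setReg (r := 24) ((Expr.reg 4).eval s₄)
  simp only [h₃.src, h₃.dst] at hb
  replace g4 : s₄.reg 4 = u := (hf.reg 4 rfl).trans g4
  replace g5 : s₄.reg 5 = s.reg 5 := (hf.reg 5 rfl).trans g5
  replace h20 : s₄.reg 20 = v := (hf.reg 20 rfl).trans h20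
  have ha4 : s₄.arr 4 = s₃.arr 4 := hf.arr 4 rfl
  refine Run.seq (run_reverse (n := n) (m := m) (start := v) (u := u) (mk := s₃.arr 3)
    (by simp [Expr.eval, g4]) hu (by simpa using h20) (by rw [h₄.arcs]; exact hval)
    (by simpa [h₄.arcs, ha4] using hmk) c₃ hnL).frame fun s₅ ⟨⟨hsame, hge, hin⟩, hf⟩ => ?_
  rw [h₄.arcs] at hsame hin
  have h₅ := h₄.of_frame_of_arcs hf rfl
  have htr : Arcs.Trade D (arcsOf s₅) m u v := ⟨hsame, hin⟩
  have hb5 : s₅.arr 5 = s₄.arr 5 := hf.arr 5 rfl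
  have hb6 : s₅.arr 6 = s₄.arr 6 := hf.arr 6 rfl
  replace g5 : s₅.reg 5 = s.reg 5 := (hf.reg 5 rfl).trans (by simpa using g5)
  refine Run.seq (h₅.run_reach (x := .const 0) hn (hsame.lt hval) hnL hmL).frame
    fun s₆ ⟨⟨h₆, hmk', _, hcl'⟩, hf⟩ => ?_
  simp only [Expr.eval] at hmk'
  replace hb5 : s₆.arr 5 = s₄.arr 5 := (hf.arr 5 rfl).trans hb5
  replace hb6 : s₆.arr 6 = s₄.arr 6 := (hf.arr 6 rfl).trans hb6
  replace g5 : s₆.reg 5 = s.reg 5 := (hf.reg 5 rfl).trans g5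
  refine Run.seq (run_someUnmarked h₆.n hnL).frame fun s₇ ⟨hall, hf⟩ => ?_
  replace hb5 : s₇.arr 5 = s₄.arr 5 := (hf.arr 5 rfl).trans hb5
  replace hb6 : s₇.arr 6 = s₄.arr 6 := (hf.arr 6 rfl).trans hb6
  replace g5 : s₇.reg 5 = s.reg 5 := (hf.reg 5 rfl).trans g5
  have h₇ := h₆.of_frame hf
  refine Run.cond (fun c₄ => ?_) fun c₄ => Run.assign (.inl ⟨arcsOf s₅, ⟨h₇.setReg _,
    hsame.trans hs, fun x hx => ?_⟩, htr.deficiency_lt hv hk (by omega) (by omega), by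
      simp [Expr.eval]⟩)
  · simp only [Expr.eval, Ne, hall, not_forall, not_not] at c₄
    obtain ⟨x, hx, hmkx⟩ := c₄
    refine (run_restore h₇.m hmL).frame.mono fun s₈ ⟨⟨hr, hr'⟩, hf⟩ => .inr
      ⟨⟨h₇.of_frame_of_arcs hf ?_, hs, hroot⟩, (hf.reg 5 rfl).trans g5, fun _ _ =>
        htr.tight_of_unreached hval hroot hcl' hmk'.start_ne hx hmkx⟩
    -- Below `m` the backup is used; from `m` on neither `reverse` nor `restore` has changed
    -- anything.
    have key : ∀ e, s₈.arr 0 e = D.src e ∧ s₈.arr 1 e = D.dst e := by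
      intro e
      rcases lt_or_ge e m with he | he
      · rw [(hr e he).1, (hr e he).2, hb5, hb6]
        exact hb e he
      · rw [(hr' e he).1, (hr' e he).2, h₇.src, h₇.dst]
        have := hge e he
        rw [h₄.src, h₄.dst] at this
        exact this
    rw [arcsOf, funext fun e => (key e).1, funext fun e => (key e).2]
  · simp only [Expr.eval] at c₄
    exact hmk'.reach (hsame.lt hval) hx (hall.1 c₄ x hx)

end KTrail

namespace KTrail

open Finset Ram

/-! ### Building the tree -/

/-- The vertex of which `w` is a copy, in the tree with root over `0` and with one copy of the head
of every edge. -/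
def Arcs.over (D : Arcs) : ℕ → ℕ
  | 0 => 0
  | e + 1 => D.dst e

/-- The edges of the tree given by `π`. -/
def treeArcs (π : ℕ → ℕ) : Arcs := ⟨π, fun e => e + 1⟩

/-- The tail of every edge is attached to the copy of it that was reached first. -/
def firstPred (D : Arcs) (pr : ℕ → ℕ) (e : ℕ) : ℕ := if D.src e = 0 then 0 else pr (D.src e) + 1

variable {D D₀ : Arcs} {k n m L : ℕ} {mk pr π : ℕ → ℕ} {s s' : State}

/-- Going to the parent replaces the tail of an edge by a vertex with a smaller mark, so the climb
ends at the root. -/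
theorem Marks.isRootedTree (h : Marks D n m 0 mk pr) (hval : ∀ e < m, D.src e < n ∧ D.dst e < n)
    (hmk : ∀ x < n, mk x ≠ 0) : IsRootedTree m (firstPred D pr) ∧
      ∀ e < m, D.over (firstPred D pr e) = D.src e := by
  have hpar : ∀ e < m, D.src e ≠ 0 → pr (D.src e) < m ∧ D.dst (pr (D.src e)) = D.src e ∧
      mk (D.src (pr (D.src e))) < mk (D.src e) := fun e he h0 =>
    have h' := (h.pred _ (hval e he).1 (hmk _ (hval e he).1)).resolve_left h0
    ⟨h'.1, h'.2.1, h'.2.2.2⟩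
  have key : ∀ r e, e < m → mk (D.src e) = r →
      ∃ t, (parent (firstPred D pr))^[t] (e + 1) = 0 := by
    intro r
    induction r using Nat.strong_induction_on with
    | _ r ih =>
      intro e he hr
      by_cases h0 : D.src e = 0
      · exact ⟨1, by simp [parent_succ, firstPred, h0]⟩
      · obtain ⟨h₁, h₂, h₃⟩ := hpar e he h0
        obtain ⟨t, ht⟩ := ih _ (hr ▸ h₃) _ h₁ rfl
        exact ⟨t + 1, by
          rw [Function.iterate_succ_apply, parent_succ, firstPred, if_neg h0, ht]⟩
  refine ⟨⟨fun e he => ?_, fun w hw => ?_⟩, fun e he => ?_⟩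
  · rw [firstPred]
    split_ifs with h0
    · exact Nat.zero_le _
    · exact (hpar e he h0).1
  · cases w with
    | zero => exact ⟨0, rfl⟩
    | succ e => exact key _ e hw rfl
  · rw [firstPred]
    split_ifs with h0
    · exact h0.symm
    · exact (hpar e he h0).2.1

/-- Pigeonhole: if the first arrival at the root were later than `m`, two earlier or equal positions
would coincide, and the detour between them could be cut out. This makes a walk of bounded length
sufficient. -/
theorem IsRootedTree.exists_iterate_le (h : IsRootedTree m π) {w : ℕ} (hw : w ≤ m) :
    ∃ t ≤ m, (parent π)^[t] w = 0 := by
  classical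
  have hex := h.reach w hw
  refine ⟨Nat.find hex, ?_, Nat.find_spec hex⟩
  by_contra hlt
  have hmaps : ∀ i ∈ range (m + 2), (parent π)^[i] w ∈ range (m + 1) := fun i _ =>
    mem_range.2 (Nat.lt_succ_of_le (h.iterate_le hw i))
  obtain ⟨i, hi, j, hj, hij, heq⟩ := exists_ne_map_eq_of_card_lt_of_maps_to (by simp) hmaps
  simp only [mem_range] at hi hj
  have main : ∀ i j, i < j → j < m + 2 → (parent π)^[i] w ≠ (parent π)^[j] w := by
    intro i j hij hj heq
    refine Nat.find_min hex (m := Nat.find hex - j + i) (by omega) ?_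
    rw [Function.iterate_add_apply, heq, ← Function.iterate_add_apply,
      Nat.sub_add_cancel (by omega)]
    exact Nat.find_spec hex
  rcases lt_or_gt_of_ne hij with h | h
  · exact main i j h hj heq
  · exact main j i h hi heq.symm

/-- Attaching a subtree at a vertex outside of it yields a tree. -/
theorem IsRootedTree.update (h : IsRootedTree m π) {e b : ℕ} (hb : b ≤ m)
    (hanc : ∀ t, (parent π)^[t] b ≠ e + 1) : IsRootedTree m (Function.update π e b) := by
  have hpar : ∀ w ≠ e + 1, parent (Function.update π e b) w = parent π w := by
    intro w hw
    cases w with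
    | zero => rfl
    | succ f =>
      rw [parent_succ, parent_succ, Function.update_of_ne fun h => hw (by rw [h])]
  -- The climb from `b` never meets `e + 1`, the only vertex whose parent changes.
  have hit : ∀ t, (parent (Function.update π e b))^[t] b = (parent π)^[t] b := by
    intro t
    induction t with
    | zero => rfl
    | succ t ih => rw [Function.iterate_succ_apply', Function.iterate_succ_apply', ih,
        hpar _ (hanc t)]
  obtain ⟨u, hu⟩ := h.reach b hb
  have key : ∀ t w, (parent π)^[t] w = 0 → ∃ t, (parent (Function.update π e b))^[t] w = 0 := by
    intro t
    induction t with
    | zero => exact fun w hw => ⟨0, hw⟩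
    | succ t ih =>
      intro w hw
      by_cases hwe : w = e + 1
      · subst hwe
        exact ⟨u + 1, by
          rw [Function.iterate_succ_apply, parent_succ, Function.update_self, hit, hu]⟩
      · rw [Function.iterate_succ_apply] at hw
        obtain ⟨t', ht'⟩ := ih _ hw
        exact ⟨t' + 1, by rw [Function.iterate_succ_apply, hpar w hwe, ht']⟩
  refine ⟨fun f hf => ?_, fun w hw => ?_⟩
  · rw [Function.update_apply]
    split_ifs
    · exact hb
    · exact h.le f hf
  · obtain ⟨t, ht⟩ := h.reach w hw
    exact key t w ht

/-! ### Balancing the degrees of the copies -/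

/-- The sum of the amounts by which degrees exceed `k`. -/
def excess (m k : ℕ) (π : ℕ → ℕ) : ℕ := ∑ w ∈ range (m + 1), ((treeArcs π).deg m w - k)

theorem excess_le (m k : ℕ) (π : ℕ → ℕ) : excess m k π ≤ (m + 1) * (m + m) := by
  have : ∀ w ∈ range (m + 1), (treeArcs π).deg m w - k ≤ m + m := fun v _ =>
    (Nat.sub_le _ _).trans (add_le_add ((card_filter_le _ _).trans_eq (card_range m))
      ((card_filter_le _ _).trans_eq (card_range m)))
  simpa [excess] using sum_le_card_nsmul _ _ _ this

theorem deg_treeArcs (m : ℕ) (π : ℕ → ℕ) (w : ℕ) : (treeArcs π).deg m w =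
    #{e ∈ range m | π e = w} + #{e ∈ range m | e + 1 = w} := rfl

theorem deg_treeArcs_update {e : ℕ} (he : e < m) (b y : ℕ) :
    (treeArcs (Function.update π e b)).deg m y + (if π e = y then 1 else 0) =
      (treeArcs π).deg m y + if b = y then 1 else 0 := by
  -- With `π` in the role of the heads, indegree counts children.
  have := Arcs.indeg_update ⟨π, π⟩ he π b y
  simp only [deg_treeArcs]
  simp only [Arcs.indeg] at this
  omega

/-- Only two degrees change, by one each: `π e` is above `k` and loses, while `b` is below `k` and
so does not come to exceed it. -/
theorem excess_update_lt {e b : ℕ} (he : e < m) (hπ : π e ≤ m)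
    (h₁ : k < (treeArcs π).deg m (π e)) (h₂ : (treeArcs π).deg m b < k) :
    excess m k (Function.update π e b) < excess m k π := by
  have hne : b ≠ π e := by rintro rfl; omega
  refine sum_lt_sum (fun y _ => ?_) ⟨π e, mem_range.2 (Nat.lt_succ_of_le hπ), ?_⟩
  · have := deg_treeArcs_update (π := π) he b y
    by_cases hy : b = y
    · subst hy
      simp only [if_true, if_neg hne.symm] at this
      omega
    · simp only [if_neg hy] at this
      omega
  · have := deg_treeArcs_update (π := π) he b (π e)
    simp only [if_true, if_neg hne] at this
    omega

/-- The edge `e` cannot be moved from a vertex of too large degree to `b`. -/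
def Stuck (D : Arcs) (m k : ℕ) (π : ℕ → ℕ) (e b : ℕ) : Prop :=
  k < (treeArcs π).deg m (π e) → (treeArcs π).deg m b < k → D.over (π e) = D.over b →
    ∃ t, (parent π)^[t] b = e + 1

theorem sum_card_filter_over (z : ℕ → ℕ) (hz : ∀ e < m, z e ≤ m) (v : ℕ) :
    ∑ w ∈ range (m + 1) with D.over w = v, #{e ∈ range m | z e = w} =
      #{e ∈ range m | D.over (z e) = v} := by
  rw [card_eq_sum_card_fiberwise (f := z) (t := {w ∈ range (m + 1) | D.over w = v})
    (fun e he => by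
      simp only [coe_filter, mem_range, Set.mem_ofPred_eq] at he ⊢
      exact ⟨Nat.lt_succ_of_le (hz e he.1), he.2⟩)]
  refine sum_congr rfl fun w hw => ?_
  rw [filter_filter]
  refine congrArg card (filter_congr fun e _ => ?_)
  have := (mem_filter.1 hw).2
  exact ⟨fun h => ⟨h ▸ this, h⟩, fun h => h.2⟩

/-- The root lies over 0, and `e + 1` lies over the head of `e`. -/
theorem card_filter_over (v : ℕ) : #{w ∈ range (m + 1) | D.over w = v} = D.copies m v := by
  rw [card_filter, sum_range_succ', Arcs.copies, Arcs.indeg, card_filter]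
  simp only [Arcs.over, eq_comm]

theorem sum_deg_over (h : IsRootedTree m π) (hover : ∀ e < m, D.over (π e) = D.src e) (v : ℕ) :
    ∑ w ∈ range (m + 1) with D.over w = v, (treeArcs π).deg m w = D.deg m v := by
  simp only [deg_treeArcs, sum_add_distrib]
  rw [sum_card_filter_over π h.le, sum_card_filter_over (fun e => e + 1) (fun e he => he)]
  exact congrArg₂ (· + ·)
    (congrArg card (filter_congr fun e he => by rw [hover e (mem_range.1 he)])) rfl

/-- If `b` exceeds `k`, then by averaging some other copy `b'` of the same vertex is below `k`.
Since `b` has two children and neither child edge can be moved to `b'`, the vertex `b'` would lie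
below both, which is impossible in a tree. -/
theorem deg_le_of_stuck (h : IsRootedTree m π) (hover : ∀ e < m, D.over (π e) = D.src e)
    (hval : ∀ e < m, D.src e < n ∧ D.dst e < n) (hn : 0 < n) (hk : 0 < k)
    (hdeg : ∀ v < n, D.deg m v ≤ k * D.copies m v)
    (hstuck : ∀ e < m, ∀ b < m + 1, Stuck D m k π e b) :
    ∀ w ≤ m, (treeArcs π).deg m w ≤ k := by
  intro b hb
  by_contra hlt
  rw [not_le] at hlt
  have hbn : D.over b < n := by
    cases b with
    | zero => exact hn
    | succ e => exact (hval e hb).2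
  obtain ⟨b', hb', hover', hlt'⟩ :
      ∃ b' ≤ m, D.over b' = D.over b ∧ (treeArcs π).deg m b' < k := by
    by_contra! hcon
    have h₁ := sum_lt_sum (s := {w ∈ range (m + 1) | D.over w = D.over b}) (f := fun _ => k)
      (g := fun w => (treeArcs π).deg m w)
      (fun w hw => by
        simp only [mem_filter, mem_range] at hw
        exact hcon w (Nat.le_of_lt_succ hw.1) hw.2)
      ⟨b, by simp; omega, hlt⟩
    rw [sum_deg_over h hover, sum_const, card_filter_over, smul_eq_mul, mul_comm] at h₁
    exact (hdeg _ hbn).not_gt h₁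
  have hin : #{e ∈ range m | e + 1 = b} ≤ 1 :=
    card_le_one.2 fun e he f hf => by
      simp only [mem_filter] at he hf
      omega
  -- At most one edge leads to the parent, and none at the root. This leaves two children unless `k
  -- = 1` and `b` is not the root.
  have hout : 1 < #{e ∈ range m | π e = b} := by
    rw [deg_treeArcs] at hlt
    rcases Nat.eq_zero_or_pos b with rfl | hpos
    · have : #{e ∈ range m | e + 1 = 0} = 0 := by simp
      omega
    rcases Nat.lt_or_ge 1 k with hk1 | hk1
    · omega
    -- `k = 1`: the vertex `b'` would be isolated
    exfalso
    have h0 : (treeArcs π).deg m b' = 0 := by omega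
    simp only [deg_treeArcs, Nat.add_eq_zero_iff, card_eq_zero,
      filter_eq_empty_iff, mem_range] at h0
    have hb'0 : b' = 0 := by
      by_contra hne
      exact h0.2 (show b' - 1 < m by omega) (by omega)
    subst hb'0
    obtain ⟨t, ht⟩ := h.reach b hb
    have : ∀ t w, 0 < w → w ≤ m → (parent π)^[t] w ≠ 0 := by
      intro t
      induction t with
      | zero => exact fun w hw _ h => hw.ne' h
      | succ t ih =>
        intro w hw hwm
        rw [Function.iterate_succ_apply]
        obtain ⟨e, rfl⟩ := Nat.exists_eq_succ_of_ne_zero hw.ne'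
        exact ih _ (Nat.pos_of_ne_zero (h0.1 hwm)) (h.le e hwm)
    exact this t b hpos hb ht
  obtain ⟨e, he, f, hf, hef⟩ := one_lt_card.1 hout
  simp only [mem_filter, mem_range] at he hf
  have hanc : ∀ e, e < m ∧ π e = b → ∃ t, (parent π)^[t] b' = e + 1 := fun e he =>
    hstuck e he.1 b' (Nat.lt_succ_of_le hb') (he.2 ▸ hlt) hlt' (by rw [he.2, hover'])
  -- A climb from `b'` through `e + 1` and later `f + 1` passes `b` twice. So `b` is periodic, hence
  -- the root, from which the climb cannot go on to `f + 1`.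
  have main : ∀ e f t u, π e = b → π f = b → (parent π)^[t] b' = e + 1 →
      (parent π)^[u] b' = f + 1 → ¬ t < u := by
    intro e f t u he hf ht hu htu
    have h₁ : (parent π)^[u - t - 1] b = f + 1 := by
      rw [← he, ← parent_succ π e, ← ht, ← Function.iterate_succ_apply' (parent π),
        ← Function.iterate_add_apply, ← hu]
      congr 1
      omega
    have h₂ : (parent π)^[u - t - 1 + 1] b = b := by
      rw [Function.iterate_succ_apply', h₁, parent_succ, hf]
    have h₃ := h.eq_zero_of_periodic hb (Nat.succ_pos _) h₂
    rw [h₃, parent_iterate_zero] at h₁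
    omega
  obtain ⟨t, ht⟩ := hanc e he
  obtain ⟨u, hu⟩ := hanc f hf
  rcases lt_trichotomy t u with h' | rfl | h'
  · exact main e f t u he.2 hf.2 ht hu h'
  · rw [ht] at hu
    omega
  · exact main f e u t hf.2 he.2 hu ht h'

/-! ### Programs that build and balance the tree -/

/-- Register `8` becomes zero if all vertices have enough copies, and non-zero otherwise. -/
def someDeficient : Prog :=
  .seq (.assign 8 (.const 0)) <| .forTo 9 1 <| .seq (.seq (.assign 10 (.reg 9)) count) <|
    .cond (.sub (.reg 13) (.reg 12)) (.assign 8 (.const 1)) .skip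

theorem run_someDeficient (h : Holds k n m D s) (hnL : n ≤ L) (hmL : m ≤ L) :
    Run L someDeficient s fun s' => s'.reg 8 = 0 ↔ ∀ v < n, D.deg m v ≤ k * D.copies m v := by
  refine Run.assign_seq (Run.forTo (fun j s' => Holds k n m D s' ∧
    (s'.reg 8 = 0 ↔ ∀ v < j, D.deg m v ≤ k * D.copies m v)) (by simpa using h.n) rfl hnL
    ⟨(h.setReg _).setReg _, by simp [Expr.eval]⟩ ?_ fun _ h => h.2)
  rintro j _ s' ⟨h, h8⟩ hj - -
  refine Run.seq (h.run_count hmL).frame fun s₁ ⟨⟨h₁, h12, h13⟩, hf⟩ => ?_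
  simp only [Expr.eval, hj] at h12 h13
  have g8 : s₁.reg 8 = s'.reg 8 := hf.reg 8 rfl
  refine Run.cond (fun c => Run.assign ⟨(h₁.setReg _).setReg _, ?_⟩)
    fun c => Run.skip ⟨h₁.setReg _, ?_⟩
  · simp only [Expr.eval, h12, h13] at c
    simp only [State.setReg_reg, Nat.reduceEqDiff, if_false, if_true, Expr.eval, one_ne_zero,
      false_iff]
    intro hall
    have := hall j (Nat.lt_succ_self j)
    omega
  · simp only [Expr.eval, h12, h13] at c
    simp only [State.setReg_reg, Nat.reduceEqDiff, if_false, g8, h8, Nat.lt_succ_iff_lt_or_eq]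
    refine ⟨fun hall v hv => ?_, fun hall v hv => hall v (.inl hv)⟩
    rcases hv with hv | rfl
    · exact hall v hv
    · omega

/-- The memory contains the number `k`, the tree given by `π`, and in array `2` the map to the
original graph. -/
structure HoldsTree (k m : ℕ) (D : Arcs) (π : ℕ → ℕ) (s : State) : Prop where
  src : s.arr 0 = π
  dst : ∀ e < m, s.arr 1 e = e + 1
  map : ∀ w ≤ m, s.arr 2 w = D.over w
  k : s.reg 0 = k
  n : s.reg 1 = m + 1
  m : s.reg 2 = m

/-- Replace the graph by a tree of which it is the homomorphic image. -/
def build : Prog :=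
  .seq (.seq (.assign 20 (.const 0)) reach) <|
  .seq (.store 2 (.const 0) (.const 0)) <|
  .seq (.forTo 30 2 <|
    .seq (.store 2 (.add (.reg 30) (.const 1)) (.get 1 (.reg 30))) <|
    .seq (.store 1 (.reg 30) (.add (.reg 30) (.const 1))) <|
    .cond (.get 0 (.reg 30))
      (.store 0 (.reg 30) (.add (.get 4 (.get 0 (.reg 30))) (.const 1))) .skip) <|
  .assign 1 (.add (.reg 2) (.const 1))

theorem run_build (h : Holds k n m D s) (hval : ∀ e < m, D.src e < n ∧ D.dst e < n) (hn : 0 < n)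
    (hroot : D.Rooted m n) (hnL : n ≤ L) (hmL : m ≤ L) :
    Run L build s fun s' => ∃ π, HoldsTree k m D π s' ∧ IsRootedTree m π ∧
      ∀ e < m, D.over (π e) = D.src e := by
  refine Run.seq (h.run_reach (x := .const 0) hn hval hnL hmL) fun s₁ ⟨h₁, hmk, _, hcl⟩ => ?_
  simp only [Expr.eval] at hmk
  obtain ⟨htree, hover⟩ := hmk.isRootedTree hval fun x hx => hmk.mk_ne_zero hcl (hroot x hx)
  -- The edges are overwritten in place: before index `j` they are those of the tree, from `j` on
  -- the original ones. Array `2` receives each head before it is lost.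
  refine Run.store_seq (Run.seq (Run.forTo (fun j s' =>
    (∀ e < j, s'.arr 0 e = firstPred D (s₁.arr 4) e ∧ s'.arr 1 e = e + 1) ∧
    (∀ e ≥ j, s'.arr 0 e = D.src e ∧ s'.arr 1 e = D.dst e) ∧
    ∀ w ≤ j, s'.arr 2 w = D.over w) (n := m) (by simpa using h₁.m) rfl hmL
    ?_ ?_ fun _ h => h).frame fun s₂ ⟨⟨i₁, i₂, i₃⟩, hf⟩ => Run.assign ?_)
  · refine ⟨by simp, fun e _ => ?_, fun w hw => ?_⟩
    · simp [h₁.src, h₁.dst]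
    · obtain rfl : w = 0 := by omega
      simp [Expr.eval, Arcs.over]
  · rintro j hj s₂ ⟨i₁, i₂, i₃⟩ h30 hr ha
    have ha4 : s₂.arr 4 = s₁.arr 4 := ha 4 rfl
    obtain ⟨hj0, hj1⟩ := i₂ j le_rfl
    have hover' : ∀ w ≤ j + 1, Function.update (s₂.arr 2) (j + 1) (D.dst j) w = D.over w := by
      intro w hw
      rcases Nat.lt_or_eq_of_le hw with hw | rfl
      · rw [Function.update_of_ne hw.ne, i₃ w (Nat.le_of_lt_succ hw)]
      · rw [Function.update_self]; rfl
    refine Run.store_seq (Run.store_seq (Run.cond (fun c => Run.store ?_) fun c => Run.skip ?_))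
    · simp only [Expr.eval, State.setArr_reg, State.setArr_arr, Nat.reduceEqDiff, if_false,
        h30, hj0, zero_ne_one, OfNat.zero_ne_ofNat] at c
      refine ⟨fun e he => ?_, fun e he => ?_, ?_⟩
      · rcases Nat.lt_succ_iff_lt_or_eq.1 he with he | rfl
        · simp [Expr.eval, h30, Function.update_of_ne he.ne, i₁ e he]
        · simp [Expr.eval, h30, hj0, ha4, firstPred, c]
      · have hne : e ≠ j := by omega
        simp [Expr.eval, h30, Function.update_of_ne hne, i₂ e (by omega)]
      · simpa [Expr.eval, h30, hj1] using hover'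
    · simp only [Expr.eval, State.setArr_reg, State.setArr_arr, Nat.reduceEqDiff, if_false,
        h30, hj0, zero_ne_one, OfNat.zero_ne_ofNat] at c
      refine ⟨fun e he => ?_, fun e he => ?_, ?_⟩
      · rcases Nat.lt_succ_iff_lt_or_eq.1 he with he | rfl
        · simp [Expr.eval, h30, Function.update_of_ne he.ne, i₁ e he]
        · simp [Expr.eval, h30, hj0, firstPred, c]
      · have hne : e ≠ j := by omega
        simp [Expr.eval, h30, Function.update_of_ne hne, i₂ e (by omega)]
      · simpa [Expr.eval, h30, hj1] using hover'
  · have g0 : s₂.reg 0 = k := (hf.reg 0 rfl).trans h₁.k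
    have g2 : s₂.reg 2 = m := (hf.reg 2 rfl).trans h₁.m
    -- The witness is the whole array, since `HoldsTree.src` is an equality of functions. It need
    -- agree with `firstPred` only below `m`, which suffices as climbs stay within `0, …, m`.
    refine ⟨s₂.arr 0, ⟨rfl, fun e he => (i₁ e he).2, i₃, by simp [g0],
      by simp [Expr.eval, g2], by simp [g2]⟩, ⟨fun e he => ?_, fun w hw => ?_⟩, fun e he => ?_⟩
    · rw [(i₁ e he).1]
      exact htree.le e he
    · have hpar : ∀ t, (parent (s₂.arr 0))^[t] w = (parent (firstPred D (s₁.arr 4)))^[t] w := by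
        intro t
        induction t with
        | zero => rfl
        | succ t ih =>
          rw [Function.iterate_succ_apply', Function.iterate_succ_apply', ih]
          have hle := htree.iterate_le hw t
          cases hx : (parent (firstPred D (s₁.arr 4)))^[t] w with
          | zero => rfl
          | succ e => rw [parent_succ, parent_succ, (i₁ e (by omega)).1]
      simpa only [hpar] using htree.reach w hw
    · rw [(i₁ e he).1]
      exact hover e he

theorem HoldsTree.setReg {s : State} (h : HoldsTree k m D π s) {r : ℕ} (c : ℕ)
    (hr : 3 ≤ r := by decide) : HoldsTree k m D π (s.setReg r c) where
  k := by rw [State.setReg_reg, if_neg (by omega), h.k]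
  n := by rw [State.setReg_reg, if_neg (by omega), h.n]
  m := by rw [State.setReg_reg, if_neg (by omega), h.m]
  src := h.src
  dst := h.dst
  map := h.map

theorem HoldsTree.of_frame {P : Prog} (h : HoldsTree k m D π s) (hf : Frame P s s')
    (hP : (P.keepsReg 0 && P.keepsReg 1 && P.keepsReg 2 && P.keepsArr 0 && P.keepsArr 1 &&
      P.keepsArr 2) = true := by rfl) : HoldsTree k m D π s' := by
  simp only [Bool.and_eq_true] at hP
  obtain ⟨⟨⟨⟨⟨h₀, h₁⟩, h₂⟩, h₃⟩, h₄⟩, h₅⟩ := hP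
  exact ⟨(hf.arr 0 h₃).trans h.src, fun e he => by rw [hf.arr 1 h₄, h.dst e he],
    fun w hw => by rw [hf.arr 2 h₅, h.map w hw],
    (hf.reg 0 h₀).trans h.k, (hf.reg 1 h₁).trans h.n, (hf.reg 2 h₂).trans h.m⟩

theorem HoldsTree.run_count (h : HoldsTree k m D π s) (hL : m ≤ L) {x : Expr} :
    Run L (.seq (.assign 10 x) count) s fun s' => HoldsTree k m D π s' ∧
      s'.reg 13 = (treeArcs π).deg m (x.eval s) := by
  have h' := h.setReg (r := 10) (x.eval s)
  refine Run.assign_seq ((KTrail.run_count h'.m hL).frame.mono fun s' ⟨⟨_, h₂⟩, hf⟩ => ?_)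
  refine ⟨h'.of_frame hf, ?_⟩
  have hsame : (arcsOf (s.setReg 10 (x.eval s))).Same m (treeArcs π) := fun e he => by
    simp [arcsOf, treeArcs, h.src, h.dst e he]
  rw [h₂, hsame.deg_eq]
  simp

/-- Register `31` becomes zero if the vertex in register `4` is not in the subtree below the edge in
register `3`, and non-zero otherwise. -/
def walk : Prog :=
  .seq (.assign 31 (.const 0)) <| .seq (.assign 32 (.reg 4)) <| .forTo 33 1 <|
    .seq (.cond (.ne (.reg 32) (.add (.reg 3) (.const 1))) .skip (.assign 31 (.const 1))) <|
    .cond (.reg 32) (.assign 32 (.get 0 (.sub (.reg 32) (.const 1)))) .skip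

theorem run_walk (h : HoldsTree k m D π s) {e b : ℕ} (he : s.reg 3 = e) (hb : s.reg 4 = b)
    (hL : m + 1 ≤ L) : Run L walk s fun s' =>
      s'.reg 31 = 0 ↔ ∀ t < m + 1, (parent π)^[t] b ≠ e + 1 := by
  refine Run.assign_seq (Run.assign_seq (Run.forTo (fun j s' => s'.reg 32 = (parent π)^[j] b ∧
    (s'.reg 31 = 0 ↔ ∀ t < j, (parent π)^[t] b ≠ e + 1)) (by simpa using h.n) rfl hL
    (by simp [Expr.eval, hb]) ?_ fun _ h => h.2))
  rintro j _ s' ⟨h32, h31⟩ hj hr ha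
  have h3 : s'.reg 3 = e := (hr 3 rfl).trans he
  have ha0 : s'.arr 0 = π := (ha 0 rfl).trans h.src
  refine Run.seq (Q' := fun s'' => s''.reg 32 = (parent π)^[j] b ∧
    (s''.reg 31 = 0 ↔ ∀ t < j + 1, (parent π)^[t] b ≠ e + 1) ∧ s''.arr = s'.arr)
    (Run.cond (fun c => Run.skip ⟨h32, ?_, rfl⟩) fun c => Run.assign ⟨by simp [h32], ?_, rfl⟩) ?_
  · rw [Ne, Expr.eval_ne] at c
    simp only [Expr.eval, h3, h32] at c
    rw [h31]
    simp only [Nat.lt_succ_iff_lt_or_eq]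
    exact ⟨fun h t ht => ht.elim (h t) fun h => h ▸ c, fun h t ht => h t (.inl ht)⟩
  · rw [Expr.eval_ne] at c
    simp only [Expr.eval, h3, h32] at c
    simp only [State.setReg_reg, if_true, Expr.eval, one_ne_zero, false_iff]
    exact fun h => h j (Nat.lt_succ_self j) c
  · rintro s'' ⟨i32, i31, iarr⟩
    refine Run.cond (fun c => Run.assign ⟨?_, by simpa using i31⟩)
      fun c => Run.skip ⟨?_, by simpa using i31⟩
    · simp only [Expr.eval, i32] at c
      obtain ⟨f, hf⟩ := Nat.exists_eq_succ_of_ne_zero c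
      rw [Function.iterate_succ_apply', hf, Nat.succ_eq_add_one, parent_succ]
      simp [Expr.eval, i32, hf, iarr, ha0]
    · simp only [Expr.eval, i32] at c
      rw [Function.iterate_succ_apply', c]
      simp [i32, c, parent]

/-- Move the edge in register `3` to the vertex in register `4` if this is possible and helps. -/
def move : Prog :=
  .seq (.seq (.assign 10 (.get 0 (.reg 3))) count) <| .cond (.sub (.reg 13) (.reg 0))
    (.seq (.seq (.assign 10 (.reg 4)) count) <| .cond (.sub (.reg 0) (.reg 13))
      (.cond (.ne (.get 2 (.get 0 (.reg 3))) (.get 2 (.reg 4))) .skip <|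
        .seq walk <| .cond (.reg 31) .skip <|
          .seq (.store 0 (.reg 3) (.reg 4)) (.assign 5 (.const 1)))
      .skip)
    .skip

/-- Move edges as long as this is possible and helps. -/
def moveAll : Prog := .search 5 <| .forTo 3 2 <| .forTo 4 1 move

theorem run_moveAll (h : HoldsTree k m D π s) (htree : IsRootedTree m π)
    (hover : ∀ e < m, D.over (π e) = D.src e) (hmL : m + 1 ≤ L) (hL : (m + 1) * (m + m) < L) :
    Run L moveAll s fun s' => ∃ π, HoldsTree k m D π s' ∧ IsRootedTree m π ∧
      (∀ e < m, D.over (π e) = D.src e) ∧ ∀ e < m, ∀ b < m + 1, Stuck D m k π e b := by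
  let Rep : (ℕ → ℕ) → State → Prop := fun π s => HoldsTree k m D π s ∧ IsRootedTree m π ∧
    ∀ e < m, D.over (π e) = D.src e
  refine Run.search₂ (Rep := Rep) (μ := excess m k) (a := π) (n := m) (m := m + 1)
    (F := fun π e b => Stuck D m k π e b) ?_ (fun D s h => h.1.m) (fun D s h => h.1.n) rfl
    ((Nat.le_succ m).trans hmL) hmL ?_ ⟨h, htree, hover⟩ ((excess_le m k π).trans_lt hL)
    (fun π s h hF => ⟨π, h.1, h.2.1, h.2.2, hF⟩)
  · rintro D s r x hr ⟨h₁, h₂⟩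
    exact ⟨h₁.setReg _ (by omega), h₂⟩
  rintro e he b hb π s ⟨h, htree, hover⟩ hse hsb
  refine Run.seq (h.run_count ((Nat.le_succ m).trans hmL)).frame fun s₁ ⟨⟨h₁, h13⟩, hf⟩ => ?_
  simp only [Expr.eval, hse, h.src] at h13
  have g3 : s₁.reg 3 = e := (hf.reg 3 rfl).trans hse
  have g4 : s₁.reg 4 = b := (hf.reg 4 rfl).trans hsb
  have g5 : s₁.reg 5 = s.reg 5 := hf.reg 5 rfl
  refine Run.cond (fun c₁ => ?_) fun c₁ => Run.skip (.inr ⟨⟨h₁, htree, hover⟩, g5, fun hd => ?_⟩)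
  swap
  · simp only [Expr.eval, h13, h₁.k] at c₁
    omega
  simp only [Expr.eval, h13, h₁.k] at c₁
  refine Run.seq (h₁.run_count ((Nat.le_succ m).trans hmL)).frame fun s₂ ⟨⟨h₂, i13⟩, hf⟩ => ?_
  simp only [Expr.eval, g4] at i13
  replace g3 : s₂.reg 3 = e := (hf.reg 3 rfl).trans g3
  replace g4 : s₂.reg 4 = b := (hf.reg 4 rfl).trans g4
  replace g5 : s₂.reg 5 = s.reg 5 := (hf.reg 5 rfl).trans g5
  refine Run.cond (fun c₂ => ?_) fun c₂ => Run.skip (.inr ⟨⟨h₂, htree, hover⟩, g5, fun _ hd => ?_⟩)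
  swap
  · simp only [Expr.eval, i13, h₂.k] at c₂
    omega
  simp only [Expr.eval, i13, h₂.k] at c₂
  have hbm := Nat.le_of_lt_succ hb
  refine Run.cond (fun c₃ => Run.skip (.inr ⟨⟨h₂, htree, hover⟩, g5, fun _ _ ho => ?_⟩))
    fun c₃ => ?_
  · rw [Ne, Expr.eval_ne] at c₃
    simp only [Expr.eval, g3, g4, h₂.src] at c₃
    rw [h₂.map _ (htree.le e he), h₂.map _ hbm] at c₃
    exact absurd ho c₃
  rw [Expr.eval_ne] at c₃
  simp only [Expr.eval, g3, g4, h₂.src] at c₃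
  rw [h₂.map _ (htree.le e he), h₂.map _ hbm] at c₃
  refine Run.seq (run_walk h₂ g3 g4 hmL).frame fun s₃ ⟨hw, hf⟩ => ?_
  have h₃ := h₂.of_frame hf
  replace g3 : s₃.reg 3 = e := (hf.reg 3 rfl).trans g3
  replace g4 : s₃.reg 4 = b := (hf.reg 4 rfl).trans g4
  replace g5 : s₃.reg 5 = s.reg 5 := (hf.reg 5 rfl).trans g5
  refine Run.cond (fun c₄ => Run.skip (.inr ⟨⟨h₃, htree, hover⟩, g5, fun _ _ _ => ?_⟩))
    fun c₄ => Run.store_seq (Run.assign (.inl ⟨Function.update π e b, ⟨?_, ?_, fun f hf => ?_⟩,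
      excess_update_lt he (htree.le e he) (by omega) (by omega), by simp [Expr.eval]⟩))
  · simp only [Expr.eval, Ne, hw, not_forall, not_not] at c₄
    obtain ⟨t, -, ht⟩ := c₄
    exact ⟨t, ht⟩
  · exact ⟨by simp [Expr.eval, g3, g4, h₃.src], by simpa using h₃.dst, by simpa using h₃.map,
      by simp [h₃.k], by simp [h₃.n], by simp [h₃.m]⟩
  · refine htree.update hbm fun t ht => ?_
    simp only [Expr.eval] at c₄
    -- The walk has examined `m + 1` positions; by then the root is reached, and later positions are
    -- 0, never `e + 1`.
    obtain ⟨u, hu, hu0⟩ := htree.exists_iterate_le hbm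
    rcases Nat.lt_or_ge t (m + 1) with htm | htm
    · exact hw.1 c₄ t htm ht
    · rw [show t = t - u + u by omega, Function.iterate_add_apply, hu0, parent_iterate_zero] at ht
      omega
  · rw [Function.update_apply]
    split_ifs with hfe
    · rw [hfe, ← c₃, hover e he]
    · exact hover f hf

/-! ### The algorithm -/

/-- Decide whether the graph is a `k`-trail, and if so, replace it by a `k`-tree of which it is the
homomorphic image. -/
def recognize : Prog :=
  .seq orient <| .seq tradeAll <| .seq someDeficient <| .cond (.reg 8)
    (.assign 0 (.const 0))
    (.seq build <| .seq moveAll <| .assign 0 (.const 1))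

/-- The test after trading decides: a demand still unmet in a blocked orientation refutes being a
`k`-trail, and if all demands are met, balancing the tree succeeds. -/
theorem run_recognize (G : EdgeList) {k : ℕ} (hk : 0 < k) (hn : 0 < G.n)
    (hconn : IsConnected G.toGraph) (hnL : G.n < L) (hmL : G.m + 1 ≤ L)
    (hL₁ : G.n * (G.m + G.m) < L) (hL₂ : (G.m + 1) * (G.m + G.m) < L) :
    Run L recognize (inputState G k) fun s =>
      (s.reg 0 = 0 ∧ ¬ IsKTrail G.toGraph k) ∨
      (s.reg 0 = 1 ∧ ∃ (H : EdgeList) (φ : Fin H.n → Fin G.n),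
        Outputs s H φ ∧ IsKTree H.toGraph k ∧ IsHomImageBy G.toGraph H.toGraph φ) := by
  -- The default 0 in `EdgeList.arcs` matches the zeros beyond the input, so the arrays agree at
  -- every index.
  have h₀ : Holds k G.n G.m G.arcs (inputState G k) := ⟨rfl, rfl, rfl, by
    simp [arcsOf, inputState, EdgeList.arcs]⟩
  have hval₀ : ∀ e < G.m, G.arcs.src e < G.n ∧ G.arcs.dst e < G.n := fun e => G.arcs_lt
  have hmL' : G.m ≤ L := (Nat.le_succ _).trans hmL
  refine Run.seq (run_orient h₀ hval₀ hn hnL hmL') ?_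
  rintro s₁ ⟨D₁, h₁, hs₁, hcl⟩
  have hroot₁ : D₁.Rooted G.m G.n := fun x hx =>
    EdgeList.mem_of_closed hconn hs₁ (S := {x | D₁.Reach G.m 0 x}) hn .refl
      (fun e he => ⟨fun h => h.tail ⟨e, he, rfl, rfl⟩, hcl e he⟩) hx
  refine Run.seq (run_tradeAll h₁ hval₀ hk hn hs₁ hroot₁ hnL.le hmL' hL₁) ?_
  rintro s₂ ⟨D, h₂, hs, hroot, hblocked⟩
  have hval := hs.lt hval₀
  refine Run.seq (run_someDeficient h₂ hnL.le hmL').frame fun s₃ ⟨hmet, hf⟩ => ?_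
  have h₃ := h₂.of_frame hf
  refine Run.cond (fun c => Run.assign (.inl ⟨by simp [Expr.eval], ?_⟩)) fun c => ?_
  · simp only [Expr.eval, Ne, hmet, not_forall, not_le] at c
    obtain ⟨v, hv, hdef⟩ := c
    exact not_isKTrail_of_stuck hs hroot hv hdef fun u hu => hblocked v hv u hu hdef
  simp only [Expr.eval] at c
  refine Run.seq (run_build h₃ hval hn hroot hnL.le hmL') ?_
  rintro s₄ ⟨π, h₄, htree, hover⟩
  refine Run.seq (run_moveAll h₄ htree hover hmL hL₂) ?_
  rintro s₅ ⟨π, h₅, htree, hover, hstuck⟩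
  have hdeg := deg_le_of_stuck htree hover hval hn hk (hmet.1 c) hstuck
  have hovern : ∀ w ≤ G.m, D.over w < G.n := fun w hw => by
    cases w with
    | zero => exact hn
    | succ e => exact (hval e hw).2
  refine Run.assign (.inr ⟨by simp [Expr.eval], treeEdgeList G.m π htree.le,
    fun w : Fin (G.m + 1) => (⟨D.over w, hovern w (Nat.le_of_lt_succ w.2)⟩ : Fin G.n), ?_,
    htree.isKTree hdeg, isHomImageBy_treeEdgeList htree.le hovern ?_ fun e he => ?_⟩)
  · refine ⟨by simp [h₅.n, treeEdgeList], by simp [h₅.m, treeEdgeList], fun e => ?_, fun w => ?_⟩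
    · exact ⟨congrFun h₅.src e, h₅.dst e e.2⟩
    · exact h₅.map w (Nat.le_of_lt_succ w.2)
  · intro u hu
    -- A vertex reachable from 0 is 0 itself or the head of an edge, so it has a copy.
    rcases (hroot u hu).cases_tail with rfl | ⟨_, -, e, he, -, rfl⟩
    · exact ⟨0, Nat.zero_le _, rfl⟩
    · exact ⟨e + 1, he, rfl⟩
  · rw [hover e he]
    exact hs e he

end KTrail

theorem theorem1 :
    ∃ (P : Ram.Prog) (p : Polynomial ℕ),
      ∀ (G : KTrail.EdgeList) (k : ℕ), 0 < k → 2 ≤ G.n → KTrail.IsConnected G.toGraph →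
        ∃ (t : ℕ) (s : Ram.State),
          Ram.Runs P (KTrail.inputState G k) t s ∧
          t ≤ p.eval (KTrail.inputSize G k) ∧
          (KTrail.IsKTrail G.toGraph k →
            s.reg 0 = 1 ∧
            ∃ (H : KTrail.EdgeList) (φ : Fin H.n → Fin G.n),
              KTrail.Outputs s H φ ∧
              KTrail.IsKTree H.toGraph k ∧
              KTrail.IsHomImageBy G.toGraph H.toGraph φ) ∧
          (¬ KTrail.IsKTrail G.toGraph k → s.reg 0 = 0) := by
  -- With N the input size, 2(N + 1)² exceeds `n`, `2nm` and `2m(m + 1)` and is at least `m + 1`, so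
  -- it bounds the iterations of every loop.
  refine ⟨KTrail.recognize,
    KTrail.recognize.time (2 * (Polynomial.X + 1) * (Polynomial.X + 1) : Polynomial ℕ),
    fun G k hk hn hconn => ?_⟩
  obtain ⟨N, hN⟩ : ∃ N, N = KTrail.inputSize G k := ⟨_, rfl⟩
  have hle : G.n ≤ N ∧ G.m ≤ N := by
    rw [hN, KTrail.inputSize]
    omega
  obtain ⟨t, s, hruns, ht, hs⟩ := KTrail.run_recognize (L := 2 * (N + 1) * (N + 1)) G hk
    (by omega) hconn (by nlinarith) (by nlinarith) (by nlinarith) (by nlinarith)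
  refine ⟨t, s, hruns, ?_, ?_⟩
  · rw [Ram.Prog.eval_time, ← hN]
    simpa using ht
  rcases hs with ⟨h₁, h₂⟩ | ⟨h₁, H, φ, hout, htree, hhom⟩
  · exact ⟨fun h => absurd h h₂, fun _ => h₁⟩
  · refine ⟨fun _ => ⟨h₁, H, φ, hout, htree, hhom⟩, fun h => absurd ?_ h⟩
    -- The tree found is itself a connected graph of maximum degree at most `k`, so a positive
    -- answer is never wrong.
    exact ⟨_, _, H.toGraph, φ, Set.toFinite _, Set.toFinite _, htree.1.2.connected, htree.2, hhom⟩
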